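/- Let $N\ge 2$ be an integer, let $\mathbb T$ be the unit circle with normalized Haar measure $\mu$, and put $e_n(z)=z^n$. A (normal) representation $\tilde\pi=(\pi,U)\in\operatorname{Rep}(\mathfrak A_N,\mathcal H)$ is a unital $*$-representation $\pi$ of $L^\infty(\mathbb T)$ on a Hilbert space $\mathcal H$ together with a unitary $U$ on $\mathcal H$ such that $U\pi(f)U^{-1}=\pi(f(z^N))$ for all $f\in L^\infty(\mathbb T)$, and such that for every $x\in\mathcal H$ the functional $f\mapsto\langle x,\pi(f)x\rangle$ is given by an $L^1(\mathbb T)$-density. A vector $x$ is cyclic if its images under the algebra generated by $\pi(L^\infty(\mathbb T))$ and $U^{\pm1}$ are dense in $\mathcal H$. Let $m_0\in L^\infty(\mathbb T)$ be a wavelet filter: $\sum_{k=0}^{N-1}|m_0(e^{2\pi i k/N}z)|^2=N$ for a.e. $z$, $m_0$ is continuous near $z=1$, and $m_0(1)=\sqrt N$. Let $R$ be the Ruelle operator $$(Rf)(z)=\frac1N\sum_{w^N=z}|m_0(w)|^2f(w).$$ The wavelet representation $\tilde\pi_\varphi=(\pi,U)$ on $L^2(\mathbb R)$ is given by $(U\psi)(x)=N^{-1/2}\psi(x/N)$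 and $(\pi(e_n)\psi)(x)=\psi(x-n)$, so that $\pi(f)$ multiplies the Fourier transform $\hat\psi(\xi)=\int_{\mathbb R} e^{-2\pi i x\xi}\psi(x)\,dx$ by $f(e^{-2\pi i\xi})$. Let $\varphi\in L^2(\mathbb R)$ be a scaling function: $U\varphi=\pi(m_0)\varphi$, normalized by $\hat\varphi(0)=1$ in the sense that $\hat\varphi(N^{-n}\xi)\to1$ as $n\to\infty$ for a.e. $\xi$ (which holds whenever $\hat\varphi$ is continuous at $0$ with value $1$ there). Let $h_\varphi\in L^1(\mathbb T)$ be the function with Fourier expansion $h_\varphi(z)=\sum_{n\in\mathbb Z}z^n\langle\pi(e_n)\varphi,\varphi\rangle$. **Theorem.** Let $h\in L^1(\mathbb T)$ be real-valued with $R(h)=h$, and suppose that $h_\varphi\le c\,h$ a.e. for some constant $c>0$. Then there is an $h$-induced representation, that is, a representation $\tilde\pi_h=(\pi_h,U_h)\in\operatorname{Rep}(\mathfrak A_N,\mathcal H_h)$ with a cyclic vector $\Phi\in\mathcal H_h$ such that $$\langle\Phi,\pi_h(f)\Phi\rangle=\int_{\mathbb T}fh\,d\mu\quad(f\in L^\infty(\mathbb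 T)),\qquad U_h\Phi=\pi_h(m_0)\Phi .$$ Every such $\tilde\pi_h$ contains the wavelet representation $\tilde\pi_\varphi$ as a subrepresentation: up to a unitary equivalence, $\mathcal H_h=L^2(\mathbb R)\oplus\mathcal K$ and $\tilde\pi_h=\tilde\pi_\varphi\oplus\tilde\pi_{\mathcal K}$ for some Hilbert space $\mathcal K$ and some $\tilde\pi_{\mathcal K}\in\operatorname{Rep}(\mathfrak A_N,\mathcal K)$. -/

import Mathlib

open MeasureTheory Filter Topology
open scoped ENNReal FourierTransform

universe u

namespace WaveletRep

/-- The circle group `𝕋`, written additively as `ℝ/ℤ`: the class of `t` stands for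
`z = exp (2πit)`, so that `z ^ n` is `fourier n t` and `z ↦ z ^ N` is `t ↦ N • t`.
Its `volume` is the normalized Haar measure. -/
abbrev Circ : Type := UnitAddCircle

/-- `L^∞(𝕋)`. -/
abbrev LInf : Type := Lp ℂ ∞ (volume : Measure Circ)

/-- `L²(ℝ)`. -/
abbrev L2R : Type := Lp ℂ 2 (volume : Measure ℝ)

theorem measurePreserving_pow (N : ℕ) [hN : N.AtLeastTwo] :
    MeasurePreserving (fun t : Circ => N • t) volume volume :=
  (AddCircle.ergodic_nsmul (T := (1 : ℝ)) hN.prop).toMeasurePreserving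

/-- The endomorphism `f(z) ↦ f(z ^ N)` of `L^∞(𝕋)`. -/
noncomputable def compPow (N : ℕ) [N.AtLeastTwo] (f : LInf) : LInf :=
  Lp.compMeasurePreserving (fun t : Circ => N • t) (measurePreserving_pow N) f

/-- The monomial `e_n(z) = z ^ n` in `L^∞(𝕋)`. -/
noncomputable def monomial (n : ℤ) : LInf :=
  ContinuousMap.toLp (E := ℂ) ∞ (volume : Measure Circ) ℂ (fourier n)

/-- A normal representation `π̃ = (π, U)` of `𝔄_N` on the Hilbert space `H`: a unital
`*`-representation `π` of `L^∞(𝕋)` and a unitary `U` with `U π(f) U⁻¹ = π(f(z ^ N))`, such that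
every vector state on `L^∞(𝕋)` has an `L¹(𝕋)`-density. -/
structure NormalRep (N : ℕ) [N.AtLeastTwo] (H : Type*) [NormedAddCommGroup H]
    [InnerProductSpace ℂ H] [CompleteSpace H] where
  π : LInf →ₗ[ℂ] (H →L[ℂ] H)
  U : H ≃ₗᵢ[ℂ] H
  π_one : π (Lp.const ∞ volume (1 : ℂ)) = 1
  π_mul : ∀ f g : LInf, π (f • g : LInf) = π f * π g
  π_star : ∀ f : LInf, π (star f) = ContinuousLinearMap.adjoint (π f)
  covariance : ∀ (f : LInf) (x : H), U (π f (U.symm x)) = π (compPow N f) x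
  normal : ∀ x : H, ∃ k : Circ → ℝ, Integrable k ∧
    ∀ f : LInf, inner ℂ x (π f x) = ∫ t, f t * (k t : ℂ)

/-! ### Dilations of `L²(ℝ)` -/

theorem memLp_dil (a : ℝ) (ha : 0 < a) (ψ : L2R) :
    MemLp (fun x : ℝ => (((√a)⁻¹ : ℝ) : ℂ) * ψ (x / a)) 2 volume := by
  refine MemLp.const_mul ?_ _
  have h1 : MemLp ψ 2 (Measure.map (fun x : ℝ => a⁻¹ * x) volume) := by
    rw [Real.map_volume_mul_left (inv_ne_zero ha.ne')]
    exact (Lp.memLp ψ).smul_measure ENNReal.ofReal_ne_top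
  have := h1.comp_of_map (f := fun x : ℝ => a⁻¹ * x) (by fun_prop)
  refine this.ae_eq (Eventually.of_forall fun x => ?_)
  simp [div_eq_inv_mul]

theorem qmp_div (a : ℝ) (ha : 0 < a) :
    Measure.QuasiMeasurePreserving (fun x : ℝ => x / a) volume volume := by
  refine ⟨by fun_prop, ?_⟩
  have : (fun x : ℝ => x / a) = fun x => a⁻¹ * x := by ext x; rw [div_eq_inv_mul]
  rw [this, Real.map_volume_mul_left (inv_ne_zero ha.ne')]
  exact Measure.smul_absolutelyContinuous

/-- `a^{-1/2} ψ(x / a)` as an element of `L²(ℝ)`. -/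
noncomputable def dilFun (a : ℝ) (ha : 0 < a) (ψ : L2R) : L2R := (memLp_dil a ha ψ).toLp

theorem coeFn_dilFun (a : ℝ) (ha : 0 < a) (ψ : L2R) :
    dilFun a ha ψ =ᵐ[volume] fun x : ℝ => (((√a)⁻¹ : ℝ) : ℂ) * ψ (x / a) :=
  (memLp_dil a ha ψ).coeFn_toLp

theorem dilFun_inv (a b : ℝ) (ha : 0 < a) (hb : 0 < b) (hab : a * b = 1) (ψ : L2R) :
    dilFun a ha (dilFun b hb ψ) = ψ := by
  apply Lp.ext
  filter_upwards [coeFn_dilFun a ha (dilFun b hb ψ),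
    (qmp_div a ha).ae (coeFn_dilFun b hb ψ)] with x h1 h2
  rw [h1, h2, div_div, hab, div_one, ← mul_assoc, ← Complex.ofReal_mul, ← mul_inv,
    ← Real.sqrt_mul ha.le, hab]
  simp

theorem inner_dilFun (a : ℝ) (ha : 0 < a) (ψ : L2R) : ‖dilFun a ha ψ‖ = ‖ψ‖ := by
  have : inner ℂ (dilFun a ha ψ) (dilFun a ha ψ) = inner ℂ ψ ψ := by
    rw [L2.inner_def, L2.inner_def]
    have h : ∫ x, inner ℂ (dilFun a ha ψ x) (dilFun a ha ψ x)
        = ∫ x, ((a⁻¹ : ℝ) : ℂ) * (fun y => inner ℂ (ψ y) (ψ y)) (x / a) := by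
      refine integral_congr_ae ?_
      filter_upwards [coeFn_dilFun a ha ψ] with x hx
      have h2 : (((√a)⁻¹ : ℝ) : ℂ) * (((√a)⁻¹ : ℝ) : ℂ) = ((a⁻¹ : ℝ) : ℂ) := by
        rw [← Complex.ofReal_mul, ← mul_inv, Real.mul_self_sqrt ha.le]
      rw [hx, ← h2]
      simp only [RCLike.inner_apply, map_mul, Complex.conj_ofReal]
      ring
    rw [h, integral_const_mul, Measure.integral_comp_div (fun y => inner ℂ (ψ y) (ψ y)) a, abs_of_pos ha, Complex.real_smul,
      ← mul_assoc, ← Complex.ofReal_mul, inv_mul_cancel₀ ha.ne']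
    simp
  rw [inner_self_eq_norm_sq_to_K, inner_self_eq_norm_sq_to_K] at this
  have h3 : ‖dilFun a ha ψ‖ ^ 2 = ‖ψ‖ ^ 2 := by exact_mod_cast this
  exact (sq_eq_sq₀ (norm_nonneg _) (norm_nonneg _)).1 h3

/-- The unitary dilation `(Dψ)(x) = a^{-1/2} ψ(x / a)` of `L²(ℝ)`. -/
noncomputable def dilation (a : ℝ) (ha : 0 < a) : L2R ≃ₗᵢ[ℂ] L2R where
  toFun := dilFun a ha
  invFun := dilFun a⁻¹ (inv_pos.2 ha)
  left_inv := dilFun_inv _ _ _ _ (inv_mul_cancel₀ ha.ne')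
  right_inv := dilFun_inv _ _ _ _ (mul_inv_cancel₀ ha.ne')
  map_add' ψ χ := by
    apply Lp.ext
    filter_upwards [coeFn_dilFun a ha (ψ + χ), coeFn_dilFun a ha ψ, coeFn_dilFun a ha χ,
      Lp.coeFn_add (dilFun a ha ψ) (dilFun a ha χ),
      (qmp_div a ha).ae (Lp.coeFn_add ψ χ)] with x h1 h2 h3 h4 h5
    rw [h1, h4, Pi.add_apply, h2, h3, h5, Pi.add_apply, mul_add]
  map_smul' c ψ := by
    apply Lp.ext
    filter_upwards [coeFn_dilFun a ha (c • ψ), coeFn_dilFun a ha ψ,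
      Lp.coeFn_smul c (dilFun a ha ψ), (qmp_div a ha).ae (Lp.coeFn_smul c ψ)] with x h1 h2 h4 h5
    rw [h1, RingHom.id_apply, h4, Pi.smul_apply, h2, h5, Pi.smul_apply, smul_eq_mul, smul_eq_mul,
      mul_left_comm]
  norm_map' := inner_dilFun a ha

theorem coeFn_dilation (a : ℝ) (ha : 0 < a) (ψ : L2R) :
    dilation a ha ψ =ᵐ[volume] fun x : ℝ => (((√a)⁻¹ : ℝ) : ℂ) * ψ (x / a) :=
  coeFn_dilFun a ha ψ

/-! ### Periodic multipliers -/

theorem qmp_neg_mk :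
    Measure.QuasiMeasurePreserving (fun ξ : ℝ => ((-ξ : ℝ) : Circ)) volume volume := by
  have hm : Measurable (fun ξ : ℝ => (ξ : Circ)) := AddCircle.measurable_mk'
  have key : Measure.QuasiMeasurePreserving (fun ξ : ℝ => (ξ : Circ)) volume volume := by
    refine ⟨hm, Measure.AbsolutelyContinuous.mk fun s hs h0 => ?_⟩
    rw [Measure.map_apply hm hs]
    have hcov : (fun ξ : ℝ => (ξ : Circ)) ⁻¹' s
        = ⋃ n : ℤ, (fun ξ : ℝ => (ξ : Circ)) ⁻¹' s ∩ Set.Ioc (n : ℝ) (n + 1) := by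
      rw [← Set.inter_iUnion, iUnion_Ioc_intCast, Set.inter_univ]
    rw [hcov, measure_iUnion_null_iff]
    intro n
    have h1 := (UnitAddCircle.measurePreserving_mk (n : ℝ)).measure_preimage hs.nullMeasurableSet
    rw [Measure.restrict_apply (hm hs), h0] at h1
    exact h1
  exact key.comp (Measure.measurePreserving_neg (volume : Measure ℝ)).quasiMeasurePreserving

theorem memLp_pull (f : LInf) :
    MemLp (fun ξ : ℝ => f ((-ξ : ℝ) : Circ)) ∞ volume := by
  refine memLp_top_of_bound
    ((Lp.aestronglyMeasurable f).comp_quasiMeasurePreserving qmp_neg_mk) ‖f‖ ?_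
  have h : ∀ᵐ t : Circ, ‖f t‖ ≤ ‖f‖ := by
    filter_upwards [ae_le_eLpNormEssSup (f := f) (μ := (volume : Measure Circ))] with t ht
    rw [Lp.norm_def, eLpNorm_exponent_top, ← ENNReal.ofReal_le_iff_le_toReal, ofReal_norm]
    · exact ht
    · rw [← eLpNorm_exponent_top]
      exact Lp.eLpNorm_ne_top f
  exact qmp_neg_mk.ae h

/-- `ξ ↦ f(e^{-2πiξ})`. -/
noncomputable def pull (f : LInf) : Lp ℂ ∞ (volume : Measure ℝ) := (memLp_pull f).toLp

theorem coeFn_pull (f : LInf) :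
    pull f =ᵐ[volume] fun ξ : ℝ => f ((-ξ : ℝ) : Circ) := (memLp_pull f).coeFn_toLp

/-- Multiplication by `f(e^{-2πiξ})` on `L²(ℝ)`. -/
noncomputable def mulOp (f : LInf) : L2R →L[ℂ] L2R :=
  (ContinuousLinearMap.mul ℂ ℂ).holderL volume ∞ 2 2 (pull f)

theorem coeFn_mulOp (f : LInf) (ψ : L2R) :
    mulOp f ψ =ᵐ[volume] fun ξ : ℝ => f ((-ξ : ℝ) : Circ) * ψ ξ := by
  have h := (ContinuousLinearMap.mul ℂ ℂ).coeFn_holder (r := 2) (pull f) ψ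
  filter_upwards [h, coeFn_pull f] with x h1 h2
  rw [← h2]
  exact h1


/-! ### The Fourier side -/

theorem fourier_dilation (a : ℝ) (ha : 0 < a) (ψ : L2R) :
    𝓕 (dilation a ha ψ) = dilation a⁻¹ (inv_pos.2 ha) (𝓕 ψ) := by
  have hd := SchwartzMap.denseRange_toLpCLM (E := ℝ) (F := ℂ) (μ := volume) (p := 2)
    ENNReal.ofNat_ne_top
  refine DenseRange.induction_on (p := fun ψ : L2R =>
    𝓕 (dilation a ha ψ) = dilation a⁻¹ (inv_pos.2 ha) (𝓕 ψ)) hd ψ ?_ ?_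
  · exact isClosed_eq
      ((Lp.fourierTransformₗᵢ ℝ ℂ).continuous.comp (dilation a ha).continuous)
      ((dilation a⁻¹ (inv_pos.2 ha)).continuous.comp (Lp.fourierTransformₗᵢ ℝ ℂ).continuous)
  intro f
  let e : ℝ ≃L[ℝ] ℝ := ContinuousLinearEquiv.smulLeft (Units.mk0 a⁻¹ (inv_ne_zero ha.ne'))
  let g : SchwartzMap ℝ ℂ := (((√a)⁻¹ : ℝ) : ℂ) • SchwartzMap.compCLMOfContinuousLinearEquiv ℂ e f
  have hg : ∀ x, g x = (((√a)⁻¹ : ℝ) : ℂ) * f (x / a) := by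
    intro x
    simp [g, e, Units.smul_def, div_eq_inv_mul]
  change 𝓕 (dilation a ha (f.toLp 2)) = dilation a⁻¹ (inv_pos.2 ha) (𝓕 (f.toLp 2))
  have h1 : dilation a ha (f.toLp 2) = g.toLp 2 := by
    apply Lp.ext
    filter_upwards [coeFn_dilation a ha (f.toLp 2),
      g.coeFn_toLp 2 volume, (qmp_div a ha).ae (f.coeFn_toLp 2 volume)] with x h1 h2 h3
    rw [h1, h2, hg]
    congr 1
  rw [h1, SchwartzMap.toLp_fourier_eq, SchwartzMap.toLp_fourier_eq]
  apply Lp.ext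
  filter_upwards [coeFn_dilation a⁻¹ (inv_pos.2 ha) ((𝓕 f).toLp 2),
    (𝓕 g).coeFn_toLp 2 volume,
    (qmp_div a⁻¹ (inv_pos.2 ha)).ae ((𝓕 f).coeFn_toLp 2 volume)] with x h3 h4 h5
  rw [h3, h4, h5, SchwartzMap.fourier_coe, SchwartzMap.fourier_coe, Real.fourier_eq,
    Real.fourier_eq]
  have h6 : ∀ v : ℝ, Real.fourierChar (-inner ℝ v x) • g v
      = (((√a)⁻¹ : ℝ) : ℂ) *
        (fun y : ℝ => Real.fourierChar (-inner ℝ y (x / a⁻¹)) • f y) (v / a) := by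
    intro v
    have : inner ℝ (v / a) (x / a⁻¹) = inner ℝ v x := by
      simp only [RCLike.inner_apply, conj_trivial]
      field_simp
    simp only [this, hg, Circle.smul_def, smul_eq_mul]
    ring
  simp_rw [h6]
  rw [integral_const_mul, Measure.integral_comp_div
    (fun y : ℝ => Real.fourierChar (-inner ℝ y (x / a⁻¹)) • f y) a, abs_of_pos ha,
    Complex.real_smul, ← mul_assoc, ← Complex.ofReal_mul]
  congr 2
  rw [Real.sqrt_inv, inv_inv, inv_mul_eq_div, Real.div_sqrt]

theorem mulOp_compPow (N : ℕ) [hN : N.AtLeastTwo] (f : LInf) (χ : L2R)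
    (h0 : (0 : ℝ) < N) :
    dilation (N : ℝ)⁻¹ (inv_pos.2 h0) (mulOp f χ)
      = mulOp (compPow N f) (dilation (N : ℝ)⁻¹ (inv_pos.2 h0) χ) := by
  apply Lp.ext
  filter_upwards [coeFn_dilation (N : ℝ)⁻¹ (inv_pos.2 h0) (mulOp f χ),
    (qmp_div (N : ℝ)⁻¹ (inv_pos.2 h0)).ae (coeFn_mulOp f χ),
    coeFn_mulOp (compPow N f) (dilation (N : ℝ)⁻¹ (inv_pos.2 h0) χ),
    coeFn_dilation (N : ℝ)⁻¹ (inv_pos.2 h0) χ,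
    qmp_neg_mk.ae (Lp.coeFn_compMeasurePreserving f (measurePreserving_pow N))]
    with x h1 h2 h3 h4 h5
  have h6 : (compPow N f) ((-x : ℝ) : Circ) = f ((-(x / (N : ℝ)⁻¹) : ℝ) : Circ) := by
    refine h5.trans ?_
    rw [Function.comp_apply, ← AddCircle.coe_nsmul]
    congr 2
    rw [nsmul_eq_mul]
    field_simp
  rw [h1, h2, h3, h4, h6]
  ring

theorem mulOp_normal (χ : L2R) : ∃ k : Circ → ℝ, Integrable k ∧
    ∀ f : LInf, inner ℂ χ (mulOp f χ) = ∫ t, f t * (k t : ℂ) := by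
  let ν : Measure ℝ := volume.withDensity fun ξ => ‖χ ξ‖ₑ ^ 2
  have hmeas : AEMeasurable (fun ξ => ‖χ ξ‖ₑ ^ 2) (volume : Measure ℝ) :=
    (Lp.aestronglyMeasurable χ).enorm.pow_const 2
  have hfin : ∫⁻ ξ, ‖χ ξ‖ₑ ^ 2 ≠ ∞ := by
    have h := (eLpNorm_lt_top_iff_lintegral_rpow_enorm_lt_top (by norm_num) (by norm_num)).1
      (Lp.memLp χ).2
    simpa using h.ne
  have : IsFiniteMeasure ν := isFiniteMeasure_withDensity hfin
  have hν : ν ≪ volume := withDensity_absolutelyContinuous _ _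
  let m : Measure Circ := ν.map fun ξ : ℝ => ((-ξ : ℝ) : Circ)
  have hm : m ≪ volume := (hν.map qmp_neg_mk.measurable).trans qmp_neg_mk.absolutelyContinuous
  refine ⟨fun t => (m.rnDeriv volume t).toReal, Measure.integrable_toReal_rnDeriv, fun f => ?_⟩
  have h1 : ∫ t, f t * (((m.rnDeriv volume t).toReal : ℝ) : ℂ) = ∫ t, f t ∂m := by
    rw [← integral_rnDeriv_smul hm]
    exact integral_congr_ae (Eventually.of_forall fun t => by
      simp only [Complex.real_smul]; ring)
  rw [h1, integral_map qmp_neg_mk.measurable.aemeasurable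
    ((Lp.aestronglyMeasurable f).mono_ac hm),
    integral_withDensity_eq_integral_toReal_smul₀ hmeas
      (Eventually.of_forall fun ξ => by finiteness), L2.inner_def]
  refine integral_congr_ae ?_
  filter_upwards [coeFn_mulOp f χ] with ξ h
  rw [h, RCLike.inner_apply, mul_assoc, RCLike.mul_conj, Complex.real_smul]
  simp [mul_comm]

theorem mulOp_add (f g : LInf) : mulOp (f + g) = mulOp f + mulOp g := by
  ext1 ψ
  apply Lp.ext
  filter_upwards [coeFn_mulOp (f + g) ψ, coeFn_mulOp f ψ, coeFn_mulOp g ψ,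
    Lp.coeFn_add (mulOp f ψ) (mulOp g ψ), qmp_neg_mk.ae (Lp.coeFn_add f g)] with x h1 h2 h3 h4 h5
  rw [add_apply, h1, h4, Pi.add_apply, h2, h3, h5, Pi.add_apply, add_mul]

theorem mulOp_smul (c : ℂ) (f : LInf) : mulOp (c • f) = c • mulOp f := by
  ext1 ψ
  apply Lp.ext
  filter_upwards [coeFn_mulOp (c • f) ψ, coeFn_mulOp f ψ,
    Lp.coeFn_smul c (mulOp f ψ), qmp_neg_mk.ae (Lp.coeFn_smul c f)] with x h1 h2 h4 h5
  rw [smul_apply, h1, h4, Pi.smul_apply, h2, h5, Pi.smul_apply, smul_eq_mul,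
    smul_eq_mul, mul_assoc]

theorem mulOp_one : mulOp (Lp.const ∞ volume (1 : ℂ)) = 1 := by
  ext1 ψ
  apply Lp.ext
  filter_upwards [coeFn_mulOp (Lp.const ∞ volume (1 : ℂ)) ψ,
    qmp_neg_mk.ae (Lp.coeFn_const (p := ∞) (μ := (volume : Measure Circ)) (1 : ℂ))] with x h1 h2
  rw [h1, h2, Function.const_apply, one_mul, one_apply_eq_self]

theorem mulOp_mul (f g : LInf) : mulOp (f • g : LInf) = mulOp f * mulOp g := by
  ext1 ψ
  apply Lp.ext
  filter_upwards [coeFn_mulOp (f • g : LInf) ψ, coeFn_mulOp f (mulOp g ψ), coeFn_mulOp g ψ,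
    qmp_neg_mk.ae (Lp.coeFn_lpSMul (r := ∞) f g)] with x h1 h2 h3 h4
  rw [mul_apply_eq_comp, h1, h2, h3, h4, Pi.smul_apply', smul_eq_mul, mul_assoc]

theorem inner_mulOp_star (f : LInf) (ψ χ : L2R) :
    inner ℂ (mulOp (star f) ψ) χ = inner ℂ ψ (mulOp f χ) := by
  rw [L2.inner_def, L2.inner_def]
  refine integral_congr_ae ?_
  filter_upwards [coeFn_mulOp (star f) ψ, coeFn_mulOp f χ, qmp_neg_mk.ae (Lp.coeFn_star f)]
    with x h1 h2 h3
  rw [h1, h2, h3, Pi.star_apply, RCLike.inner_apply, RCLike.inner_apply, map_mul,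
    RCLike.star_def, RCLike.conj_conj]
  ring

/-- The wavelet representation of `𝔄_N` on `L²(ℝ)`: `(Uψ)(x) = N^{-1/2} ψ(x / N)`, and `π(f)` is
the operator which multiplies the Fourier transform by `f(e^{-2πiξ})`. In particular
`(π(e_n)ψ)(x) = ψ(x - n)`, see `waveletRep_monomial`. -/
noncomputable def waveletRep (N : ℕ) [hN : N.AtLeastTwo] : NormalRep N L2R :=
  let F := Lp.fourierTransformₗᵢ ℝ ℂ
  { π :=
      { toFun := fun f => (F.symm : L2R →L[ℂ] L2R) ∘L mulOp f ∘L (F : L2R →L[ℂ] L2R)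
        map_add' := fun f g => by ext1 ψ; simp [mulOp_add]
        map_smul' := fun c f => by ext1 ψ; simp [mulOp_smul] }
    U := dilation N (Nat.cast_pos.2 (by have := hN.prop; omega))
    π_one := by ext1 ψ; simp [mulOp_one]
    π_mul := fun f g => by ext1 ψ; simp [mulOp_mul]
    π_star := fun f => by
      rw [ContinuousLinearMap.eq_adjoint_iff]
      intro ψ χ
      change inner ℂ (F.symm (mulOp (star f) (F ψ))) χ = inner ℂ ψ (F.symm (mulOp f (F χ)))
      rw [← F.inner_map_map, ← F.inner_map_map ψ, F.apply_symm_apply, F.apply_symm_apply,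
        inner_mulOp_star]
    covariance := fun f ψ => by
      have h0 : (0 : ℝ) < N := Nat.cast_pos.2 (by have := hN.prop; omega)
      have key : ∀ χ : L2R, F (dilation N h0 χ) = dilation (N : ℝ)⁻¹ (inv_pos.2 h0) (F χ) :=
        fourier_dilation N h0
      change dilation N h0 (F.symm (mulOp f (F ((dilation N h0).symm ψ))))
        = F.symm (mulOp (compPow N f) (F ψ))
      apply F.injective
      rw [key, F.apply_symm_apply, F.apply_symm_apply, mulOp_compPow N f _ h0, ← key,
        LinearIsometryEquiv.apply_symm_apply]
    normal := fun ψ => by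
      obtain ⟨k, hk, h⟩ := mulOp_normal (F ψ)
      refine ⟨k, hk, fun f => ?_⟩
      rw [← h f, ← F.inner_map_map]
      change inner ℂ (F ψ) (F (F.symm (mulOp f (F ψ)))) = _
      rw [F.apply_symm_apply] }

theorem waveletRep_U (N : ℕ) [hN : N.AtLeastTwo] (ψ : L2R) :
    (waveletRep N).U ψ =ᵐ[volume] fun x : ℝ => (((√(N : ℝ))⁻¹ : ℝ) : ℂ) * ψ (x / N) :=
  coeFn_dilation N (Nat.cast_pos.2 (by have := hN.prop; omega)) ψ

theorem waveletRep_monomial (N : ℕ) [hN : N.AtLeastTwo] (n : ℤ) (ψ : L2R) :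
    (waveletRep N).π (monomial n) ψ =ᵐ[volume] fun x : ℝ => ψ (x - n) := by
  have hmp : MeasurePreserving (fun x : ℝ => x - n) volume volume :=
    measurePreserving_sub_right volume (n : ℝ)
  suffices h : (waveletRep N).π (monomial n) ψ
      = Lp.compMeasurePreserving (fun x : ℝ => x - n) hmp ψ by
    rw [h]; exact Lp.coeFn_compMeasurePreserving ψ hmp
  have hd := SchwartzMap.denseRange_toLpCLM (E := ℝ) (F := ℂ) (μ := volume) (p := 2)
    ENNReal.ofNat_ne_top
  refine DenseRange.induction_on (p := fun ψ : L2R => (waveletRep N).π (monomial n) ψ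
      = Lp.compMeasurePreserving (fun x : ℝ => x - n) hmp ψ) hd ψ ?_ ?_
  · exact isClosed_eq ((waveletRep N).π (monomial n)).continuous
      (Lp.isometry_compMeasurePreserving hmp).continuous
  intro f
  change (waveletRep N).π (monomial n) (f.toLp 2)
      = Lp.compMeasurePreserving (fun x : ℝ => x - n) hmp (f.toLp 2)
  let g : SchwartzMap ℝ ℂ := SchwartzMap.compSubConstCLM ℂ (n : ℝ) f
  have hg : ∀ x, g x = f (x - n) := fun x => rfl
  have h1 : Lp.compMeasurePreserving (fun x : ℝ => x - n) hmp (f.toLp 2) = g.toLp 2 := by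
    apply Lp.ext
    filter_upwards [Lp.coeFn_compMeasurePreserving (f.toLp 2) hmp,
      g.coeFn_toLp 2 volume, hmp.quasiMeasurePreserving.ae (f.coeFn_toLp 2 volume)] with x h1 h2 h3
    rw [h1, h2, hg, Function.comp_apply, h3]
  rw [h1]
  change (Lp.fourierTransformₗᵢ ℝ ℂ).symm (mulOp (monomial n) (𝓕 (f.toLp 2))) = g.toLp 2
  rw [LinearIsometryEquiv.symm_apply_eq]
  change _ = 𝓕 (g.toLp 2)
  rw [SchwartzMap.toLp_fourier_eq, SchwartzMap.toLp_fourier_eq]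
  apply Lp.ext
  filter_upwards [coeFn_mulOp (monomial n) ((𝓕 f).toLp 2), (𝓕 f).coeFn_toLp 2 volume,
    (𝓕 g).coeFn_toLp 2 volume,
    qmp_neg_mk.ae (ContinuousMap.coeFn_toLp (p := ∞) (𝕜 := ℂ) (volume : Measure Circ)
      (fourier n : C(Circ, ℂ)))] with x h1 h2 h3 h4
  rw [h1, h2, h3]
  have h5 : monomial n ((-x : ℝ) : Circ) = fourier n ((-x : ℝ) : Circ) := h4
  rw [h5, SchwartzMap.fourier_coe, SchwartzMap.fourier_coe, Real.fourier_eq', Real.fourier_eq',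
    ← integral_sub_right_eq_self _ (n : ℝ), ← integral_const_mul]
  congr 1
  ext v
  rw [hg, fourier_coe_apply, smul_eq_mul, smul_eq_mul, ← mul_assoc, ← Complex.exp_add]
  congr 2
  simp only [RCLike.inner_apply, conj_trivial]
  push_cast
  ring

theorem star_mono (n : ℤ) : star (monomial n) = monomial (-n) := by
  apply Lp.ext
  filter_upwards [Lp.coeFn_star (monomial n),
    ContinuousMap.coeFn_toLp (p := ∞) (𝕜 := ℂ) (volume : Measure Circ) (fourier n : C(Circ, ℂ)),
    ContinuousMap.coeFn_toLp (p := ∞) (𝕜 := ℂ) (volume : Measure Circ)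
      (fourier (-n) : C(Circ, ℂ))] with t h1 h2 h3
  have h2' : monomial n t = fourier n t := h2
  have h3' : monomial (-n) t = fourier (-n) t := h3
  rw [h1, Pi.star_apply, h2', h3', fourier_neg, RCLike.star_def]

section
variable {N : ℕ} [N.AtLeastTwo] {H : Type*} [NormedAddCommGroup H] [InnerProductSpace ℂ H]
  [CompleteSpace H]

theorem NormalRep.exists_density (ρ : NormalRep N H) (x : H) : ∃ k : Circ → ℝ, Integrable k ∧
    ∀ n : ℤ, ∫ t, fourier (-n) t * (k t : ℂ) = inner ℂ (ρ.π (monomial n) x) x := by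
  obtain ⟨k, hk, h⟩ := ρ.normal x
  refine ⟨k, hk, fun n => ?_⟩
  rw [← ContinuousLinearMap.adjoint_inner_right, ← ρ.π_star, star_mono, h]
  refine integral_congr_ae ?_
  filter_upwards [ContinuousMap.coeFn_toLp (p := ∞) (𝕜 := ℂ) (volume : Measure Circ)
      (fourier (-n) : C(Circ, ℂ))] with t h3
  have h3' : monomial (-n) t = fourier (-n) t := h3
  rw [h3']

/-- The function `h_x(z) = ∑ₙ zⁿ ⟨π(e_n)x, x⟩`: the (a.e. unique) real function in `L¹(𝕋)` whose
`n`-th Fourier coefficient is `⟨π(e_n)x, x⟩` for every `n`. -/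
noncomputable def NormalRep.density (ρ : NormalRep N H) (x : H) : Circ → ℝ :=
  (ρ.exists_density x).choose

/-- `x` is cyclic: the vectors `π̃(A)x`, with `A` in the algebra generated by `L^∞(𝕋)` and
`U, U⁻¹`, are dense. -/
def NormalRep.IsCyclicVector (ρ : NormalRep N H) (x : H) : Prop :=
  Dense {y : H | ∃ A ∈ Algebra.adjoin ℂ
    (Set.range ρ.π ∪ {(ρ.U : H →L[ℂ] H), (ρ.U.symm : H →L[ℂ] H)}), y = A x}

/-- `(ρ, Φ)` is the representation of `𝔄_N` induced by `h` (relative to the filter `m`): the cyclic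
representation with `⟨Φ, π(f)Φ⟩ = ∫ f h dμ` and `UΦ = π(m)Φ`. -/
structure NormalRep.IsInduced (m : LInf) (h : Circ → ℝ) (ρ : NormalRep N H) (Φ : H) : Prop where
  cyclic : ρ.IsCyclicVector Φ
  state : ∀ f : LInf, inner ℂ Φ (ρ.π f Φ) = ∫ t, f t * (h t : ℂ)
  scaling : ρ.U Φ = ρ.π m Φ

/-- `ρ` is (unitarily equivalent to) the orthogonal direct sum `ρ₁ ⊕ ρ₂`. -/
def NormalRep.IsDirectSum {H₁ H₂ : Type*} [NormedAddCommGroup H₁] [InnerProductSpace ℂ H₁]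
    [CompleteSpace H₁] [NormedAddCommGroup H₂] [InnerProductSpace ℂ H₂] [CompleteSpace H₂]
    (ρ : NormalRep N H) (ρ₁ : NormalRep N H₁) (ρ₂ : NormalRep N H₂) : Prop :=
  ∃ T : H ≃ₗᵢ[ℂ] WithLp 2 (H₁ × H₂),
    (∀ (f : LInf) (x : H), T (ρ.π f x) = WithLp.toLp 2 (ρ₁.π f (T x).fst, ρ₂.π f (T x).snd)) ∧
    ∀ x : H, T (ρ.U x) = WithLp.toLp 2 (ρ₁.U (T x).fst, ρ₂.U (T x).snd)

end

/-- The Ruelle operator `(Rf)(z) = N⁻¹ ∑_{w ^ N = z} |m₀(w)|² f(w)`. -/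
noncomputable def ruelle (N : ℕ) (m₀ : Circ → ℂ) (f : Circ → ℝ) (t : Circ) : ℝ :=
  (N : ℝ)⁻¹ * ∑ᶠ s ∈ {s : Circ | N • s = t}, ‖m₀ s‖ ^ 2 * f s

/-- Wavelet (low-pass) filters. -/
structure IsWaveletFilter (N : ℕ) (m₀ : Circ → ℂ) : Prop where
  memLp : MemLp m₀ ∞ volume
  quadrature : ∀ᵐ t : Circ,
    ∑ k ∈ Finset.range N, ‖m₀ ((((k : ℝ) / N : ℝ) : Circ) + t)‖ ^ 2 = N
  continuousAt : ∀ᶠ t in 𝓝 (0 : Circ), ContinuousAt m₀ t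
  lowPass : m₀ 0 = ((√(N : ℝ) : ℝ) : ℂ)

/-- `φ ∈ L²(ℝ)` is a scaling function for the filter `m`: `Uφ = π(m)φ`, normalized by `φ̂(0) = 1`.
Since `φ̂` is only an `L²`-function, the value at `0` is read as the limit of `φ̂(N⁻ⁿ ξ)` as `n → ∞`,
for almost every `ξ`; this is implied by `φ̂(0) = 1` when `φ̂` is continuous at `0`, in particular
when `φ` is integrable. -/
structure IsScalingFunction (N : ℕ) [N.AtLeastTwo] (m : LInf) (φ : L2R) : Prop where
  scaling : (waveletRep N).U φ = (waveletRep N).π m φ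
  normalized : ∀ᵐ ξ : ℝ, Tendsto (fun n : ℕ => (𝓕 φ : L2R) (ξ / (N : ℝ) ^ n)) atTop (𝓝 1)

end WaveletRep

namespace WaveletRep

/-! ### The endomorphism `f(z) ↦ f(z ^ N)` -/

section compPow
variable (N : ℕ) [N.AtLeastTwo]

/-! Since 0 ≤ h_φ ≤ c h, the function h is nonnegative.

Existence. The equation R(h) = h says that z ↦ z^N transports |m₀|² h dμ to ν = h dμ
(`isHarmonicMeasure_withDensity`). Hence S g(z) = m₀(z) g(z^N) is an isometry of L²(ν) that
satisfies the covariance relation with multiplication operators, and the constant 1 has state f ↦ ∫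
f h dμ and satisfies S1 = m₀. The isometry S extends to a unitary on L²(ν) ⊕ ℓ²(ker S*), on which
L^∞ acts diagonally (`IsometricRep.dilationRep`). The closed invariant subspace generated by 1 is
then an h-induced representation.

Containment. As ‖π(f)x‖² is the integral of |f|² against the density of x, the bound h_φ ≤ c h
becomes ‖π(f)φ‖ ≤ √c ‖π_h(f)Φ‖. By the scaling relation the vectors U_h⁻ⁿ π_h(f)Φ increase with n to
an invariant subspace, dense because Φ is cyclic. So U_h⁻ⁿ π_h(f)Φ ↦ U⁻ⁿ π(f)φ extends to a bounded
intertwining operator W : H_h → L²(ℝ) with WΦ = φ (`IsCyclicVector.exists_intertwines`). Because φ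
is cyclic (`isCyclicVector_waveletRep`), W has dense range, that is, W* is injective. The polar
decomposition W* = V (W W*)^{1/2} gives an isometry V : L²(ℝ) → H_h, which intertwines since square
roots commute with whatever commutes with W W* (`Intertwines.exists_isometry`). The range of V and
its orthogonal complement are the two summands.

Cyclicity of φ. A closed invariant subspace M is stable under U⁻ⁿ π(e_k) Uⁿ, translation by k/Nⁿ. If
g ⊥ M and ψ ∈ M, the product of ĝ with the conjugate of ψ̂ therefore has a Fourier transform
vanishing at all N-adic rationals, and so is zero. With ψ = U⁻ʲφ this reads φ̂(N⁻ʲξ) = 0 or ĝ(ξ) =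
0, and φ̂(N⁻ʲξ) → 1 leaves ĝ = 0. -/

theorem coeFn_compPow (f : LInf) : compPow N f =ᵐ[volume] fun t => f (N • t) :=
  Lp.coeFn_compMeasurePreserving f (measurePreserving_pow N)

theorem ae_pow {p : Circ → Prop} (h : ∀ᵐ t, p t) : ∀ᵐ t : Circ, p (N • t) :=
  (measurePreserving_pow N).quasiMeasurePreserving.ae h

theorem compPow_add (f g : LInf) : compPow N (f + g) = compPow N f + compPow N g := by
  apply Lp.ext
  filter_upwards [coeFn_compPow N (f + g), coeFn_compPow N f, coeFn_compPow N g,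
    Lp.coeFn_add (compPow N f) (compPow N g), ae_pow N (Lp.coeFn_add f g)] with t h1 h2 h3 h4 h5
  rw [h1, h4, Pi.add_apply, h2, h3, h5, Pi.add_apply]

theorem compPow_smul (c : ℂ) (f : LInf) : compPow N (c • f) = c • compPow N f := by
  apply Lp.ext
  filter_upwards [coeFn_compPow N (c • f), coeFn_compPow N f,
    Lp.coeFn_smul c (compPow N f), ae_pow N (Lp.coeFn_smul c f)] with t h1 h2 h4 h5
  rw [h1, h4, Pi.smul_apply, h2, h5, Pi.smul_apply]

theorem compPow_mul (f g : LInf) : compPow N (f • g : LInf) = (compPow N f • compPow N g : LInf) := by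
  apply Lp.ext
  filter_upwards [coeFn_compPow N (f • g : LInf), coeFn_compPow N f, coeFn_compPow N g,
    Lp.coeFn_lpSMul (r := ∞) (compPow N f) (compPow N g),
    ae_pow N (Lp.coeFn_lpSMul (r := ∞) f g)] with t h1 h2 h3 h4 h5
  rw [h1, h4, Pi.smul_apply', h2, h3, h5, Pi.smul_apply']

theorem compPow_star (f : LInf) : compPow N (star f) = star (compPow N f) := by
  apply Lp.ext
  filter_upwards [coeFn_compPow N (star f), coeFn_compPow N f,
    Lp.coeFn_star (compPow N f), ae_pow N (Lp.coeFn_star f)] with t h1 h2 h4 h5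
  rw [h1, h4, Pi.star_apply, h2, h5, Pi.star_apply]

theorem compPow_one :
    compPow N (Lp.const ∞ volume (1 : ℂ)) = Lp.const ∞ volume (1 : ℂ) := by
  apply Lp.ext
  filter_upwards [coeFn_compPow N (Lp.const ∞ volume (1 : ℂ)),
    Lp.coeFn_const (p := ∞) (μ := (volume : Measure Circ)) (1 : ℂ),
    ae_pow N (Lp.coeFn_const (p := ∞) (μ := (volume : Measure Circ)) (1 : ℂ))] with t h1 h2 h3
  rw [h1, h2, h3]
  rfl

theorem norm_compPow (f : LInf) : ‖compPow N f‖ = ‖f‖ :=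
  Lp.norm_compMeasurePreserving f (measurePreserving_pow N)

end compPow

/-! ### Invariant subspaces and subrepresentations -/

namespace NormalRep

variable {N : ℕ} [N.AtLeastTwo] {H : Type*} [NormedAddCommGroup H] [InnerProductSpace ℂ H]
  [CompleteSpace H] (ρ : NormalRep N H)

theorem inner_π_left (f : LInf) (x y : H) : inner ℂ (ρ.π f x) y = inner ℂ x (ρ.π (star f) y) := by
  rw [ρ.π_star, ContinuousLinearMap.adjoint_inner_right]

theorem π_π (f g : LInf) (x : H) : ρ.π f (ρ.π g x) = ρ.π (f • g : LInf) x := by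
  rw [ρ.π_mul]; rfl

theorem U_π (f : LInf) (x : H) : ρ.U (ρ.π f x) = ρ.π (compPow N f) (ρ.U x) := by
  rw [← ρ.covariance, LinearIsometryEquiv.symm_apply_apply]

theorem π_U_symm (f : LInf) (x : H) : ρ.π f (ρ.U.symm x) = ρ.U.symm (ρ.π (compPow N f) x) := by
  rw [LinearIsometryEquiv.eq_symm_apply, ρ.covariance]

/-- `M` is invariant under `π(L^∞(𝕋))`, `U` and `U⁻¹`. -/
structure IsInvariant (M : Submodule ℂ H) : Prop where
  π_mem : ∀ (f : LInf), ∀ x ∈ M, ρ.π f x ∈ M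
  U_mem : ∀ x ∈ M, ρ.U x ∈ M
  U_symm_mem : ∀ x ∈ M, ρ.U.symm x ∈ M

variable {ρ}

theorem IsInvariant.topologicalClosure {M : Submodule ℂ H} (hM : ρ.IsInvariant M) :
    ρ.IsInvariant M.topologicalClosure where
  π_mem f _ hx := map_mem_closure (ρ.π f).continuous hx fun y hy => hM.π_mem f y hy
  U_mem _ hx := map_mem_closure ρ.U.continuous hx fun y hy => hM.U_mem y hy
  U_symm_mem _ hx := map_mem_closure ρ.U.symm.continuous hx fun y hy => hM.U_symm_mem y hy

/-- The acting operators are closed under adjoints: π(f)* = π(f̄) and U* = U⁻¹. -/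
theorem IsInvariant.orthogonal {M : Submodule ℂ H} (hM : ρ.IsInvariant M) :
    ρ.IsInvariant Mᗮ where
  π_mem f x hx := by
    rw [Submodule.mem_orthogonal] at hx ⊢
    intro u hu
    have h : ρ.π f = ContinuousLinearMap.adjoint (ρ.π (star f)) := by rw [← ρ.π_star, star_star]
    rw [h, ContinuousLinearMap.adjoint_inner_right]
    exact hx _ (hM.π_mem _ _ hu)
  U_mem x hx := by
    rw [Submodule.mem_orthogonal] at hx ⊢
    intro u hu
    rw [← ρ.U.apply_symm_apply u, LinearIsometryEquiv.inner_map_map]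
    exact hx _ (hM.U_symm_mem _ hu)
  U_symm_mem x hx := by
    rw [Submodule.mem_orthogonal] at hx ⊢
    intro u hu
    rw [← ρ.U.symm_apply_apply u, LinearIsometryEquiv.inner_map_map]
    exact hx _ (hM.U_mem _ hu)

/-- The operators preserving M form an algebra containing the generators, so M contains the whole
orbit of x, which is dense. -/
theorem IsCyclicVector.eq_top {x : H} (hx : ρ.IsCyclicVector x) {M : Submodule ℂ H}
    (hM : ρ.IsInvariant M) (hc : IsClosed (M : Set H)) (hxM : x ∈ M) : M = ⊤ := by
  have key : ∀ A ∈ Algebra.adjoin ℂ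
      (Set.range ρ.π ∪ {(ρ.U : H →L[ℂ] H), (ρ.U.symm : H →L[ℂ] H)}), ∀ y ∈ M, A y ∈ M := by
    intro A hA
    induction hA using Algebra.adjoin_induction with
    | mem A hA =>
      rcases hA with ⟨f, rfl⟩ | rfl | rfl
      · exact hM.π_mem f
      · exact hM.U_mem
      · exact hM.U_symm_mem
    | algebraMap c => intro y hy; simpa [Algebra.algebraMap_eq_smul_one] using M.smul_mem c hy
    | add A B _ _ hA hB => intro y hy; exact M.add_mem (hA y hy) (hB y hy)
    | mul A B _ _ hA hB => intro y hy; exact hA _ (hB y hy)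
  rw [eq_top_iff]
  intro y _
  refine closure_minimal ?_ hc (hx y)
  rintro _ ⟨A, hA, rfl⟩
  exact key A hA x hxM

/-- The orbit of x under the generated algebra is itself an invariant subspace, so the hypothesis
applies to its closure. -/
theorem isCyclicVector_of_forall {x : H} (h : ∀ M : Submodule ℂ H, ρ.IsInvariant M →
    IsClosed (M : Set H) → x ∈ M → M = ⊤) : ρ.IsCyclicVector x := by
  let 𝒜 := Algebra.adjoin ℂ
    (Set.range ρ.π ∪ {(ρ.U : H →L[ℂ] H), (ρ.U.symm : H →L[ℂ] H)})
  let M : Submodule ℂ H := (Subalgebra.toSubmodule 𝒜).map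
    (ContinuousLinearMap.apply ℂ H x : (H →L[ℂ] H) →ₗ[ℂ] H)
  have hmul : ∀ B ∈ 𝒜, ∀ y ∈ M, B y ∈ M := by
    rintro B hB _ ⟨A, hA, rfl⟩
    exact ⟨B * A, 𝒜.mul_mem hB hA, rfl⟩
  have hM : ρ.IsInvariant M :=
    ⟨fun f => hmul _ (Algebra.subset_adjoin (Or.inl ⟨f, rfl⟩)),
      hmul _ (Algebra.subset_adjoin (Or.inr (Or.inl rfl))),
      hmul _ (Algebra.subset_adjoin (Or.inr (Or.inr rfl)))⟩
  have htop := h _ hM.topologicalClosure M.isClosed_topologicalClosure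
    (M.le_topologicalClosure ⟨1, 𝒜.one_mem, rfl⟩)
  intro y
  have hy : y ∈ M.topologicalClosure := htop ▸ Submodule.mem_top
  refine closure_mono ?_ hy
  rintro _ ⟨A, hA, rfl⟩
  exact ⟨A, hA, rfl⟩

/-- The restriction of a representation to a closed invariant subspace. -/
noncomputable def IsInvariant.restrict {M : Submodule ℂ H} [CompleteSpace M]
    (hM : ρ.IsInvariant M) : NormalRep N M where
  π :=
    { toFun := fun f => ((ρ.π f).comp M.subtypeL).codRestrict M fun x => hM.π_mem f x x.2
      map_add' := fun f g => by ext x; simp; rfl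
      map_smul' := fun c f => by ext x; simp; rfl }
  U :=
    { toFun := fun x => ⟨ρ.U x, hM.U_mem x x.2⟩
      invFun := fun x => ⟨ρ.U.symm x, hM.U_symm_mem x x.2⟩
      left_inv := fun x => by ext; simp
      right_inv := fun x => by ext; simp
      map_add' := fun x y => by ext; simp
      map_smul' := fun c x => by ext; simp
      norm_map' := fun x => ρ.U.norm_map x }
  π_one := by ext x; simp [ρ.π_one]
  π_mul f g := by ext x; simp [ρ.π_mul]; rfl
  π_star f := by
    rw [ContinuousLinearMap.eq_adjoint_iff]
    intro x y
    change inner ℂ (ρ.π (star f) x) (y : H) = inner ℂ (x : H) (ρ.π f y)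
    rw [ρ.inner_π_left, star_star]
  covariance f x := by ext; exact ρ.covariance f x
  normal x := ρ.normal x

/-- The restriction of a representation to the closed invariant subspace generated by a vector
satisfying the scaling relation is an induced representation. -/
theorem exists_isInduced_restrict (ρ : NormalRep N H) (m : LInf) (h : Circ → ℝ) (x : H)
    (hstate : ∀ f : LInf, inner ℂ x (ρ.π f x) = ∫ t, f t * (h t : ℂ))
    (hscal : ρ.U x = ρ.π m x) :
    ∃ (M : Submodule ℂ H) (_ : CompleteSpace M) (σ : NormalRep N M) (y : M),
      σ.IsInduced m h y := by
  let M : Submodule ℂ H := sInf {M | ρ.IsInvariant M ∧ IsClosed (M : Set H) ∧ x ∈ M}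
  have hM : ρ.IsInvariant M :=
    ⟨fun f y hy => by
        rw [Submodule.mem_sInf] at hy ⊢; exact fun L hL => hL.1.π_mem f y (hy L hL),
      fun y hy => by
        rw [Submodule.mem_sInf] at hy ⊢; exact fun L hL => hL.1.U_mem y (hy L hL),
      fun y hy => by
        rw [Submodule.mem_sInf] at hy ⊢; exact fun L hL => hL.1.U_symm_mem y (hy L hL)⟩
  have hc : IsClosed (M : Set H) := by
    rw [Submodule.coe_sInf]
    exact isClosed_biInter fun L hL => hL.2.1
  have hx : x ∈ M := by rw [Submodule.mem_sInf]; exact fun L hL => hL.2.2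
  have : CompleteSpace M := hc.completeSpace_coe
  refine ⟨M, inferInstance, hM.restrict, ⟨x, hx⟩, ?_, hstate, Subtype.ext hscal⟩
  refine isCyclicVector_of_forall fun L hL hLc hxL => ?_
  -- Seen in H, a closed invariant subspace L of M containing x is one of the subspaces intersected
  -- to form M, so it is all of M.
  have hL' : ρ.IsInvariant (L.map M.subtype) :=
    ⟨by rintro f _ ⟨y, hy, rfl⟩; exact ⟨_, hL.π_mem f y hy, rfl⟩,
      by rintro _ ⟨y, hy, rfl⟩; exact ⟨_, hL.U_mem y hy, rfl⟩,
      by rintro _ ⟨y, hy, rfl⟩; exact ⟨_, hL.U_symm_mem y hy, rfl⟩⟩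
  have hLc' : IsClosed ((L.map M.subtype : Submodule ℂ H) : Set H) := by
    rw [Submodule.map_coe]
    exact hc.isClosedEmbedding_subtypeVal.isClosedMap _ hLc
  rw [eq_top_iff]
  rintro ⟨y, hy⟩ _
  obtain ⟨z, hz, hzy⟩ := (Submodule.mem_sInf.1 hy) _ ⟨hL', hLc', ⟨_, hxL, rfl⟩⟩
  have : z = ⟨y, hy⟩ := Subtype.ext hzy
  exact this ▸ hz

end NormalRep
/-! ### Densities of vector states -/

theorem ae_norm_le (f : LInf) : ∀ᵐ t, ‖f t‖ ≤ ‖f‖ := by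
  filter_upwards [ae_le_eLpNormEssSup (f := f) (μ := (volume : Measure Circ))] with t ht
  rw [Lp.norm_def, eLpNorm_exponent_top, ← ENNReal.ofReal_le_iff_le_toReal, ofReal_norm]
  · exact ht
  · rw [← eLpNorm_exponent_top]
    exact Lp.eLpNorm_ne_top f

theorem integrable_mul_coe (f : LInf) {k : Circ → ℝ} (hk : Integrable k) :
    Integrable (fun t => f t * (k t : ℂ)) volume :=
  hk.ofReal.bdd_mul (c := ‖f‖) (Lp.aestronglyMeasurable f) (ae_norm_le f)

/-- An integrable function on the circle is determined by its Fourier coefficients. -/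
theorem ae_eq_of_integral_fourier_eq {k l : Circ → ℝ} (hk : Integrable k) (hl : Integrable l)
    (h : ∀ n : ℤ, ∫ t, fourier n t * (k t : ℂ) = ∫ t, fourier n t * (l t : ℂ)) :
    k =ᵐ[volume] l := by
  have hint : ∀ (g : C(Circ, ℂ)) {u : Circ → ℝ}, Integrable u →
      Integrable (fun t => g t * (u t : ℂ)) volume := fun g u hu =>
    hu.ofReal.bdd_mul (c := ‖g‖) g.continuous.aestronglyMeasurable
      (Eventually.of_forall g.norm_coe_le_norm)
  let d : Circ → ℝ := k - l
  have hd : Integrable d := hk.sub hl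
  have hL : ∀ g : C(Circ, ℂ), ∫ t, g t * (d t : ℂ) = 0 := by
    -- Integration against d is a bounded functional on C(𝕋) that kills all monomials; their span is
    -- dense, so it is zero.
    let L : C(Circ, ℂ) →L[ℂ] ℂ := LinearMap.mkContinuous
      { toFun := fun g => ∫ t, g t * (d t : ℂ)
        map_add' := fun f g => by
          rw [← integral_add (hint f hd) (hint g hd)]
          simp [add_mul]
        map_smul' := fun c f => by
          rw [RingHom.id_apply, smul_eq_mul, ← integral_const_mul]
          simp [mul_assoc] } (∫ t, ‖d t‖) (fun g => by
        refine (norm_integral_le_integral_norm _).trans ?_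
        rw [mul_comm, ← integral_const_mul]
        refine integral_mono (hint g hd).norm (hd.norm.const_mul _) fun t => ?_
        simp only [norm_mul, Complex.norm_real]
        gcongr
        exact g.norm_coe_le_norm t)
    have hLf : ∀ n : ℤ, L (fourier n) = 0 := by
      intro n
      change ∫ t, fourier n t * (d t : ℂ) = 0
      simp only [d, Pi.sub_apply, Complex.ofReal_sub, mul_sub]
      rw [integral_sub (hint _ hk) (hint _ hl), h, sub_self]
    have hle : (Submodule.span ℂ (Set.range (@fourier 1))).topologicalClosure ≤ L.ker :=
      Submodule.topologicalClosure_minimal _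
        (Submodule.span_le.2 (by rintro _ ⟨n, rfl⟩; exact hLf n)) L.isClosed_ker
    intro g
    have : g ∈ L.ker := hle (by rw [span_fourier_closure_eq_top]; trivial)
    exact this
  have hd0 : d =ᵐ[volume] 0 := by
    -- The positive and negative parts of d define finite measures with equal integrals of
    -- continuous functions. They coincide, so d⁺ = d⁻ a.e., which forces d = 0.
    let μp : Measure Circ := volume.withDensity fun t => ENNReal.ofReal (d t)
    let μn : Measure Circ := volume.withDensity fun t => ENNReal.ofReal (-d t)
    have : IsFiniteMeasure μp := isFiniteMeasure_withDensity_ofReal hd.2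
    have : IsFiniteMeasure μn := isFiniteMeasure_withDensity_ofReal hd.neg.2
    have hmeas := hd.aemeasurable
    have hmeasn : AEMeasurable (fun t => -d t) volume := hmeas.neg
    have heq : μp = μn := by
      refine ext_of_forall_integral_eq_of_IsFiniteMeasure fun g => ?_
      rw [integral_withDensity_eq_integral_toReal_smul₀ hmeas.ennreal_ofReal
          (Eventually.of_forall fun _ => ENNReal.ofReal_lt_top),
        integral_withDensity_eq_integral_toReal_smul₀ hmeasn.ennreal_ofReal
          (Eventually.of_forall fun _ => ENNReal.ofReal_lt_top), ← sub_eq_zero]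
      have hgb : ∀ {u : Circ → ℝ}, Integrable u → Integrable (fun t => u t • g t) := fun hu =>
        hu.mul_bdd (c := ‖g‖) g.continuous.aestronglyMeasurable
          (Eventually.of_forall g.norm_coe_le_norm)
      have e1 : Integrable (fun t => (ENNReal.ofReal (d t)).toReal • g t) :=
        hgb (by simpa [ENNReal.toReal_ofReal'] using hd.pos_part)
      have e2 : Integrable (fun t => (ENNReal.ofReal (-d t)).toReal • g t) :=
        hgb (by simpa [ENNReal.toReal_ofReal'] using hd.neg_part)
      rw [← integral_sub e1 e2]
      have := hL ⟨fun t => (g t : ℂ), by fun_prop⟩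
      simp only [ContinuousMap.coe_mk, ← Complex.ofReal_mul] at this
      rw [integral_complex_ofReal, Complex.ofReal_eq_zero] at this
      rw [← this]
      refine integral_congr_ae (Eventually.of_forall fun t => ?_)
      simp only [ENNReal.toReal_ofReal', smul_eq_mul]
      rcases le_total 0 (d t) with h0 | h0
      · rw [max_eq_left h0, max_eq_right (by linarith)]; ring
      · rw [max_eq_right h0, max_eq_left (by linarith)]; ring
    have hae := (withDensity_eq_iff hmeas.ennreal_ofReal hmeasn.ennreal_ofReal
      (by rw [← setLIntegral_univ, ← withDensity_apply _ MeasurableSet.univ]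
          exact measure_ne_top μp _)).1 heq
    filter_upwards [hae] with t ht
    have h1 := congrArg ENNReal.toReal ht
    simp only [ENNReal.toReal_ofReal'] at h1
    rw [Pi.zero_apply]
    rcases le_total 0 (d t) with h0 | h0
    · rw [max_eq_left h0, max_eq_right (by linarith)] at h1; linarith
    · rw [max_eq_right h0, max_eq_left (by linarith)] at h1; linarith
  filter_upwards [hd0] with t ht
  exact sub_eq_zero.1 ht

section
variable {N : ℕ} [N.AtLeastTwo] {H : Type*} [NormedAddCommGroup H] [InnerProductSpace ℂ H]
  [CompleteSpace H] (ρ : NormalRep N H)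

theorem NormalRep.integrable_density (x : H) : Integrable (ρ.density x) :=
  (ρ.exists_density x).choose_spec.1

theorem coeFn_monomial (n : ℤ) : monomial n =ᵐ[volume] fun t => fourier n t :=
  ContinuousMap.coeFn_toLp (p := ∞) (𝕜 := ℂ) (volume : Measure Circ) (fourier n : C(Circ, ℂ))

/-- `density` is pinned down only by its Fourier coefficients, whereas `normal` provides a function
representing the state on all of L^∞. Uniqueness of Fourier coefficients identifies the two. -/
theorem NormalRep.inner_π_self (x : H) (f : LInf) :
    inner ℂ x (ρ.π f x) = ∫ t, f t * (ρ.density x t : ℂ) := by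
  obtain ⟨k, hk, h⟩ := ρ.normal x
  have : k =ᵐ[volume] ρ.density x := by
    refine ae_eq_of_integral_fourier_eq hk (ρ.integrable_density x) fun n => ?_
    have h1 := (ρ.exists_density x).choose_spec.2 (-n)
    rw [neg_neg, ρ.inner_π_left, star_mono, neg_neg, h] at h1
    refine Eq.trans ?_ h1.symm
    refine integral_congr_ae ?_
    filter_upwards [coeFn_monomial n] with t ht
    rw [ht]
  rw [h]
  refine integral_congr_ae ?_
  filter_upwards [this] with t ht
  rw [ht]

/-- ‖π(f)x‖² = ⟨x, π(f̄f)x⟩. This is what turns an inequality between densities into one between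
norms; k may be any function representing the state, so it serves both h and `density`. -/
theorem NormalRep.norm_π_sq (x : H) (f : LInf) {k : Circ → ℝ}
    (hk : ∀ g : LInf, inner ℂ x (ρ.π g x) = ∫ t, g t * (k t : ℂ)) :
    ‖ρ.π f x‖ ^ 2 = ∫ t, ‖f t‖ ^ 2 * k t := by
  have h1 : inner ℂ (ρ.π f x) (ρ.π f x) = ∫ t, ((‖f t‖ ^ 2 * k t : ℝ) : ℂ) := by
    rw [ρ.inner_π_left, ρ.π_π, hk]
    refine integral_congr_ae ?_
    filter_upwards [Lp.coeFn_lpSMul (r := ∞) (star f) f, Lp.coeFn_star f] with t h2 h3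
    rw [h2, Pi.smul_apply', h3, Pi.star_apply, smul_eq_mul, RCLike.star_def, RCLike.conj_mul]
    simp
  rw [integral_complex_ofReal, inner_self_eq_norm_sq_to_K] at h1
  refine Complex.ofReal_injective (h1 ▸ ?_)
  simp

theorem integrable_normSq_mul (f : LInf) {k : Circ → ℝ} (hk : Integrable k) :
    Integrable (fun t => ‖f t‖ ^ 2 * k t) volume := by
  have h1 := (integrable_mul_coe (star f • f : LInf) hk).re
  refine h1.congr ?_
  filter_upwards [Lp.coeFn_lpSMul (r := ∞) (star f) f, Lp.coeFn_star f] with t h2 h3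
  rw [h2, Pi.smul_apply', h3, Pi.star_apply, smul_eq_mul, RCLike.star_def, RCLike.conj_mul]
  have h4 : (RCLike.ofReal (‖f t‖ ^ 2) : ℂ) * (k t : ℂ) = ((‖f t‖ ^ 2 * k t : ℝ) : ℂ) := by simp
  rw [← RCLike.ofReal_pow, h4]
  rfl

/-- The integral of the density over s equals ‖π(1_s)x‖². -/
theorem NormalRep.density_nonneg (x : H) : ∀ᵐ t, 0 ≤ ρ.density x t := by
  refine ae_nonneg_of_forall_setIntegral_nonneg (ρ.integrable_density x) fun s hs _ => ?_
  let f : LInf := indicatorConstLp ∞ hs (measure_ne_top _ _) (1 : ℂ)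
  have h1 := ρ.norm_π_sq x f (ρ.inner_π_self x)
  have h2 : ∫ t, ‖f t‖ ^ 2 * ρ.density x t = ∫ t in s, ρ.density x t := by
    rw [← integral_indicator hs]
    refine integral_congr_ae ?_
    filter_upwards [indicatorConstLp_coeFn (p := ∞) (hs := hs) (hμs := measure_ne_top volume s)
      (c := (1 : ℂ))] with t ht
    rw [ht]
    by_cases hts : t ∈ s <;> simp [hts]
  rw [← h2, ← h1]
  positivity

end
/-! ### Intertwining operators -/

namespace NormalRep

section level
variable {N : ℕ} [N.AtLeastTwo] {H : Type*} [NormedAddCommGroup H] [InnerProductSpace ℂ H]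
  [CompleteSpace H] (ρ : NormalRep N H)

/-- The vector `U⁻ⁿ π(f) x`. -/
noncomputable def level (x : H) (n : ℕ) (f : LInf) : H := ρ.U.symm^[n] (ρ.π f x)

theorem level_zero (x : H) (f : LInf) : ρ.level x 0 f = ρ.π f x := rfl

theorem U_symm_level (x : H) (n : ℕ) (f : LInf) :
    ρ.U.symm (ρ.level x n f) = ρ.level x (n + 1) f :=
  (Function.iterate_succ_apply' _ _ _).symm

theorem level_add (x : H) (n : ℕ) (f g : LInf) :
    ρ.level x n (f + g) = ρ.level x n f + ρ.level x n g := by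
  induction n with
  | zero => simp [level_zero]
  | succ n ih => rw [← U_symm_level, ih, map_add, U_symm_level, U_symm_level]

theorem level_smul (x : H) (n : ℕ) (c : ℂ) (f : LInf) :
    ρ.level x n (c • f) = c • ρ.level x n f := by
  induction n with
  | zero => simp [level_zero]
  | succ n ih => rw [← U_symm_level, ih, map_smul, U_symm_level]

theorem norm_level (x : H) (n : ℕ) (f : LInf) : ‖ρ.level x n f‖ = ‖ρ.π f x‖ := by
  induction n with
  | zero => rfl
  | succ n ih => rw [← U_symm_level, LinearIsometryEquiv.norm_map, ih]

/-- Each passage of π(g) through U⁻¹ replaces g(z) by g(z^N). -/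
theorem π_level (x : H) (n : ℕ) (f g : LInf) :
    ρ.π g (ρ.level x n f) = ρ.level x n ((compPow N)^[n] g • f : LInf) := by
  induction n generalizing g with
  | zero => exact ρ.π_π g f x
  | succ n ih =>
    rw [← U_symm_level, π_U_symm, ih, U_symm_level, Function.iterate_succ_apply]

variable {ρ} {m : LInf} {x : H}

/-- From Uπ(f)x = π(f(z^N))Ux = π(f(z^N) m)x. The levels are therefore nested in n, and their union
is a subspace. -/
theorem level_succ (hx : ρ.U x = ρ.π m x) (n : ℕ) (f : LInf) :
    ρ.level x (n + 1) (compPow N f • m : LInf) = ρ.level x n f := by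
  rw [level, level, Function.iterate_succ_apply, ← π_π, ← hx, ← U_π,
    LinearIsometryEquiv.symm_apply_apply]

theorem level_add_iterate (hx : ρ.U x = ρ.π m x) (n k : ℕ) (f : LInf) :
    ρ.level x (n + k) ((fun g : LInf => (compPow N g • m : LInf))^[k] f) = ρ.level x n f := by
  induction k generalizing f with
  | zero => rfl
  | succ k ih =>
    rw [Function.iterate_succ_apply', ← add_assoc, level_succ hx, ih]

end level

variable {N : ℕ} [N.AtLeastTwo] {H : Type*} [NormedAddCommGroup H] [InnerProductSpace ℂ H]
  [CompleteSpace H] {ρ : NormalRep N H} {H' : Type*} [NormedAddCommGroup H']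
  [InnerProductSpace ℂ H'] [CompleteSpace H'] {ρ' : NormalRep N H'}

/-- `W` intertwines the representations `ρ` and `ρ'`. -/
structure Intertwines (ρ : NormalRep N H) (ρ' : NormalRep N H') (W : H →L[ℂ] H') : Prop where
  π : ∀ (f : LInf) (x : H), W (ρ.π f x) = ρ'.π f (W x)
  U : ∀ x : H, W (ρ.U x) = ρ'.U (W x)

theorem Intertwines.U_symm {W : H →L[ℂ] H'} (hW : Intertwines ρ ρ' W) (x : H) :
    W (ρ.U.symm x) = ρ'.U.symm (W x) := by
  rw [LinearIsometryEquiv.eq_symm_apply, ← hW.U, LinearIsometryEquiv.apply_symm_apply]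

/-- Take adjoints in the relation for f̄, using π(f̄) = π(f)*; unitarity of U plays the same role.
-/
theorem Intertwines.adjoint {W : H →L[ℂ] H'} (hW : Intertwines ρ ρ' W) :
    Intertwines ρ' ρ (ContinuousLinearMap.adjoint W) where
  π f x := by
    refine ext_inner_left ℂ fun y => ?_
    rw [ContinuousLinearMap.adjoint_inner_right, ← star_star f, ← ρ'.inner_π_left, ← hW.π,
      ← ρ.inner_π_left, ContinuousLinearMap.adjoint_inner_right]
  U x := by
    refine ext_inner_left ℂ fun y => ?_
    rw [ContinuousLinearMap.adjoint_inner_right, ← ρ.U.apply_symm_apply y, hW.U,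
      LinearIsometryEquiv.inner_map_map, LinearIsometryEquiv.inner_map_map,
      ContinuousLinearMap.adjoint_inner_right]

/-- A cyclic vector whose norms dominate those of `y` is mapped to `y` by an intertwining
operator, if both vectors satisfy the same scaling relation. -/
theorem IsCyclicVector.exists_intertwines {x : H} (hx : ρ.IsCyclicVector x) {y : H'} {m : LInf}
    (hxm : ρ.U x = ρ.π m x) (hym : ρ'.U y = ρ'.π m y) (C : ℝ)
    (hC : ∀ f : LInf, ‖ρ'.π f y‖ ≤ C * ‖ρ.π f x‖) :
    ∃ W : H →L[ℂ] H', Intertwines ρ ρ' W ∧ W x = y := by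
  -- The intended graph of U⁻ⁿπ(f)x ↦ U⁻ⁿπ(f)y. Handling pairs avoids having to know yet that the
  -- assignment is well defined.
  let G : Submodule ℂ (H × H') :=
    { carrier := {p | ∃ n f, p = (ρ.level x n f, ρ'.level y n f)}
      zero_mem' := ⟨0, 0, by simp [level_zero]; rfl⟩
      smul_mem' := by
        rintro c _ ⟨n, f, rfl⟩
        exact ⟨n, c • f, by simp [level_smul]⟩
      add_mem' := by
        rintro _ _ ⟨n, f, rfl⟩ ⟨k, g, rfl⟩
        -- Both summands are pushed to the common level n + k; the same functions work for x and y
        -- because both obey the scaling relation with m.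
        refine ⟨n + k, (fun g : LInf => (compPow N g • m : LInf))^[k] f +
          (fun g : LInf => (compPow N g • m : LInf))^[n] g, ?_⟩
        rw [level_add, level_add, level_add_iterate hxm, level_add_iterate hym, add_comm n k,
          level_add_iterate hxm, level_add_iterate hym]
        rfl }
  have hGπ : ∀ (f : LInf), ∀ p ∈ G, (ρ.π f p.1, ρ'.π f p.2) ∈ G := by
    rintro f _ ⟨n, g, rfl⟩
    exact ⟨n, _, Prod.ext (ρ.π_level x n g f) (ρ'.π_level y n g f)⟩
  have hGU' : ∀ p ∈ G, (ρ.U.symm p.1, ρ'.U.symm p.2) ∈ G := by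
    rintro _ ⟨n, g, rfl⟩
    exact ⟨n + 1, g, Prod.ext (ρ.U_symm_level x n g) (ρ'.U_symm_level y n g)⟩
  have hGU : ∀ p ∈ G, (ρ.U p.1, ρ'.U p.2) ∈ G := by
    rintro _ ⟨n, g, rfl⟩
    refine ⟨n, (compPow N g • m : LInf), ?_⟩
    have h1 := ρ.U_symm_level x n (compPow N g • m : LInf)
    have h2 := ρ'.U_symm_level y n (compPow N g • m : LInf)
    rw [level_succ hxm, LinearIsometryEquiv.symm_apply_eq] at h1
    rw [level_succ hym, LinearIsometryEquiv.symm_apply_eq] at h2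
    exact Prod.ext h1.symm h2.symm
  let e : G →ₗ[ℂ] H := LinearMap.fst ℂ H H' ∘ₗ G.subtype
  let w : G →ₗ[ℂ] H' := LinearMap.snd ℂ H H' ∘ₗ G.subtype
  have hxy : (x, y) ∈ G := ⟨0, Lp.const ∞ volume (1 : ℂ), by simp [level_zero, π_one]⟩
  have hinv : ρ.IsInvariant (LinearMap.range e) :=
    ⟨by rintro f _ ⟨p, rfl⟩; exact ⟨⟨_, hGπ f p p.2⟩, rfl⟩,
      by rintro _ ⟨p, rfl⟩; exact ⟨⟨_, hGU p p.2⟩, rfl⟩,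
      by rintro _ ⟨p, rfl⟩; exact ⟨⟨_, hGU' p p.2⟩, rfl⟩⟩
  have htop := hx.eq_top hinv.topologicalClosure (Submodule.isClosed_topologicalClosure _)
    (Submodule.le_topologicalClosure _ ⟨⟨_, hxy⟩, rfl⟩)
  have he : DenseRange e := (Submodule.dense_iff_topologicalClosure_eq_top).2 htop
  -- U⁻ⁿ is isometric on both sides, so the bound at level 0 suffices. It makes w factor through e
  -- and extend boundedly from the dense range of e.
  have hbd : ∀ p, ‖w p‖ ≤ C * ‖e p‖ := by
    rintro ⟨_, n, f, rfl⟩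
    change ‖ρ'.level y n f‖ ≤ C * ‖ρ.level x n f‖
    rw [norm_level, norm_level]
    exact hC f
  let W : H →L[ℂ] H' := w.extendOfNorm e
  have hW : ∀ p ∈ G, W p.1 = p.2 := fun p hp =>
    LinearMap.extendOfNorm_eq he ⟨C, hbd⟩ ⟨p, hp⟩
  refine ⟨W, ⟨fun f z => ?_, fun z => ?_⟩, hW _ hxy⟩
  · refine he.induction_on (p := fun z => W (ρ.π f z) = ρ'.π f (W z)) z
      (isClosed_eq (by fun_prop) (by fun_prop)) fun p => ?_
    exact (hW _ (hGπ f p p.2)).trans (congrArg _ (hW p p.2).symm)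
  · refine he.induction_on (p := fun z => W (ρ.U z) = ρ'.U (W z)) z
      (isClosed_eq (by fun_prop) (by fun_prop)) fun p => ?_
    exact (hW _ (hGU p p.2)).trans (congrArg _ (hW p p.2).symm)

/-- The isometric part in the polar decomposition of an injective intertwining operator. -/
theorem Intertwines.exists_isometry {W : H →L[ℂ] H'} (hW : Intertwines ρ ρ' W)
    (hinj : Function.Injective W) :
    ∃ V : H →ₗᵢ[ℂ] H', Intertwines ρ ρ' V.toContinuousLinearMap := by
  let T : H →L[ℂ] H := (ContinuousLinearMap.adjoint W).comp W
  have hT : Intertwines ρ ρ T :=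
    ⟨fun f x => by
      change ContinuousLinearMap.adjoint W (W _) = ρ.π f (ContinuousLinearMap.adjoint W (W x))
      rw [hW.π, hW.adjoint.π],
    fun x => by
      change ContinuousLinearMap.adjoint W (W _) = ρ.U (ContinuousLinearMap.adjoint W (W x))
      rw [hW.U, hW.adjoint.U]⟩
  have hpos : 0 ≤ T := by
    rw [ContinuousLinearMap.nonneg_iff_isPositive]
    exact ContinuousLinearMap.isPositive_adjoint_comp_self W
  -- A is the modulus |W|. Since ‖Wx‖ = ‖Ax‖, the map Ax ↦ Wx is isometric on the range of A.
  let A : H →L[ℂ] H := CFC.sqrt T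
  have hAA : A * A = T := CFC.sqrt_mul_sqrt_self T hpos
  have hAsa : ∀ x y, inner ℂ (A x) y = inner ℂ x (A y) := by
    have h1 : 0 ≤ A := CFC.sqrt_nonneg T
    rw [ContinuousLinearMap.nonneg_iff_isPositive] at h1
    exact fun x y => h1.isSymmetric x y
  have hcomm : ∀ B : H →L[ℂ] H, (∀ x, T (B x) = B (T x)) → ∀ x, A (B x) = B (A x) := by
    intro B hB x
    have h1 : Commute T B := ContinuousLinearMap.ext hB
    have h2 : Commute A B := h1.cfcₙ_nnreal _
    exact congrArg (fun S : H →L[ℂ] H => S x) h2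
  have hAρ : Intertwines ρ ρ A :=
    ⟨fun f => hcomm (ρ.π f) (hT.π f),
      hcomm (ρ.U : H →L[ℂ] H) hT.U⟩
  have hnorm : ∀ x, ‖W x‖ = ‖A x‖ := by
    intro x
    have h1 : inner ℂ (W x) (W x) = inner ℂ (A x) (A x) := by
      rw [hAsa, ← ContinuousLinearMap.adjoint_inner_right]
      change inner ℂ x (T x) = inner ℂ x ((A * A) x)
      rw [hAA]
    rw [inner_self_eq_norm_sq_to_K, inner_self_eq_norm_sq_to_K] at h1
    have h3 : ‖W x‖ ^ 2 = ‖A x‖ ^ 2 := by exact_mod_cast h1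
    exact (sq_eq_sq₀ (norm_nonneg _) (norm_nonneg _)).1 h3
  -- A is self-adjoint, so the complement of its range is ker A = ker W = 0.
  have hdense : DenseRange (A : H →ₗ[ℂ] H) := by
    have h1 : (LinearMap.range (A : H →ₗ[ℂ] H))ᗮ = ⊥ := by
      rw [eq_bot_iff]
      intro z hz
      rw [Submodule.mem_orthogonal] at hz
      have h2 : A z = 0 := by
        rw [← inner_self_eq_zero (𝕜 := ℂ), ← hAsa]
        exact hz _ ⟨A z, rfl⟩
      have h3 : W z = 0 := by rw [← norm_eq_zero, hnorm, h2, norm_zero]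
      exact hinj (h3.trans (map_zero W).symm)
    exact (Submodule.dense_iff_topologicalClosure_eq_top).2
      ((Submodule.topologicalClosure_eq_top_iff).2 h1)
  have hbd : ∀ x, ‖(W : H →ₗ[ℂ] H') x‖ ≤ 1 * ‖(A : H →ₗ[ℂ] H) x‖ := fun x => by
    rw [one_mul]; exact (hnorm x).le
  let V : H →L[ℂ] H' := (W : H →ₗ[ℂ] H').extendOfNorm (A : H →ₗ[ℂ] H)
  have hV : ∀ x, V (A x) = W x := fun x => LinearMap.extendOfNorm_eq hdense ⟨1, hbd⟩ x
  refine ⟨⟨V, fun x => ?_⟩, fun f x => ?_, fun x => ?_⟩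
  · refine hdense.induction_on (p := fun z => ‖V z‖ = ‖z‖) x
      (isClosed_eq (by fun_prop) (by fun_prop)) fun z => ?_
    exact (congrArg norm (hV z)).trans (hnorm z)
  · refine hdense.induction_on (p := fun z => V (ρ.π f z) = ρ'.π f (V z)) x
      (isClosed_eq (by fun_prop) (by fun_prop)) fun z => ?_
    change V (ρ.π f (A z)) = ρ'.π f (V (A z))
    rw [← hAρ.π, hV, hV, hW.π]
  · refine hdense.induction_on (p := fun z => V (ρ.U z) = ρ'.U (V z)) x
      (isClosed_eq (by fun_prop) (by fun_prop)) fun z => ?_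
    change V (ρ.U (A z)) = ρ'.U (V (A z))
    rw [← hAρ.U, hV, hV, hW.U]

/-- An isometric intertwining operator exhibits its domain as a direct summand. -/
theorem Intertwines.exists_isDirectSum {V : H →ₗᵢ[ℂ] H'}
    (hV : Intertwines ρ ρ' V.toContinuousLinearMap) :
    ∃ (K : Submodule ℂ H') (_ : CompleteSpace K) (σ : NormalRep N K), ρ'.IsDirectSum ρ σ := by
  let M : Submodule ℂ H' := LinearMap.range V.toLinearMap
  have hM : ρ'.IsInvariant M :=
    ⟨by rintro f _ ⟨x, rfl⟩; exact ⟨_, hV.π f x⟩, by rintro _ ⟨x, rfl⟩; exact ⟨_, hV.U x⟩,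
      by rintro _ ⟨x, rfl⟩; exact ⟨_, hV.U_symm x⟩⟩
  have hMc : CompleteSpace M := by
    have h1 : IsComplete (Set.range V) :=
      V.isometry.isUniformInducing.isComplete_range
    exact h1.completeSpace_coe
  let K := Mᗮ
  have hK : ρ'.IsInvariant K := hM.orthogonal
  -- Isometric by Pythagoras, and onto because the range of V is complete.
  let S : WithLp 2 (H × K) →ₗᵢ[ℂ] H' :=
    { toFun := fun p => V p.fst + (p.snd : H')
      map_add' := fun p q => by
        simp only [WithLp.add_fst, WithLp.add_snd, map_add, Submodule.coe_add]
        abel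
      map_smul' := fun c p => by simp [smul_add]
      norm_map' := fun p => by
        have h1 : inner ℂ (V p.fst) (p.snd : H') = 0 :=
          (Submodule.mem_orthogonal _ _).1 p.snd.2 _ ⟨p.fst, rfl⟩
        have h2 := norm_add_sq_eq_norm_sq_add_norm_sq_of_inner_eq_zero _ _ h1
        have h3 := WithLp.prod_norm_sq_eq_of_L2 p
        rw [← sq_eq_sq₀ (norm_nonneg _) (norm_nonneg _), h3, sq, sq, sq]
        simpa using h2 }
  have hS : Function.Surjective S := by
    intro z
    obtain ⟨u, ⟨x, rfl⟩, v, hv, rfl⟩ := M.exists_add_mem_mem_orthogonal z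
    exact ⟨WithLp.toLp 2 (x, ⟨v, hv⟩), rfl⟩
  let T := LinearIsometryEquiv.ofSurjective S hS
  have hTS : ∀ p, T p = V p.fst + (p.snd : H') := fun p => rfl
  refine ⟨K, inferInstance, hK.restrict, T.symm, fun f z => ?_, fun z => ?_⟩
  · rw [LinearIsometryEquiv.symm_apply_eq, hTS]
    conv_lhs => rw [← T.apply_symm_apply z, hTS, map_add]
    exact congrArg (· + _) (hV.π f _).symm
  · rw [LinearIsometryEquiv.symm_apply_eq, hTS]
    conv_lhs => rw [← T.apply_symm_apply z, hTS, map_add]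
    exact congrArg (· + _) (hV.U _).symm

end NormalRep
/-! ### Scaling functions are cyclic for the wavelet representation -/

/-- An integrable function on the line whose Fourier transform vanishes is zero. -/
theorem ae_eq_zero_of_fourier_eq_zero {g : ℝ → ℂ} (hg : Integrable g)
    (h : ∀ x, 𝓕 g x = 0) : g =ᵐ[volume] 0 := by
  refine ae_eq_zero_of_integral_contDiff_smul_eq_zero hg.locallyIntegrable fun u hu hc => ?_
  have hu₁ : HasCompactSupport (Complex.ofRealCLM ∘ u) := hc.comp_left rfl
  have hu₂ : ContDiff ℝ ((⊤ : ℕ∞) : WithTop ℕ∞) (Complex.ofRealCLM ∘ u) :=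
    Complex.ofRealCLM.contDiff.comp hu
  let w : SchwartzMap ℝ ℂ := hu₁.toSchwartzMap hu₂
  -- The test function is the Fourier transform of the Schwartz function v, so its pairing with g
  -- equals the pairing of v with the transform of g, which is zero.
  let v : SchwartzMap ℝ ℂ := 𝓕⁻ w
  have hv : 𝓕 v = w := FourierTransform.fourier_fourierInv_eq w
  have key : ∫ ξ, 𝓕 (v : ℝ → ℂ) ξ • g ξ = ∫ x, v x • 𝓕 g x := by
    simpa using! VectorFourier.integral_fourierIntegral_smul_eq_flip (L := innerₗ ℝ)
      Real.continuous_fourierChar continuous_inner v.integrable hg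
  simp only [h, smul_zero, integral_zero] at key
  rw [← SchwartzMap.fourier_coe, hv] at key
  simpa [w] using key

/-! ### The wavelet representation on the Fourier side -/

section
variable {N : ℕ} [hN : N.AtLeastTwo]

theorem fourier_π (ψ : L2R) (f : LInf) :
    (𝓕 ((waveletRep N).π f ψ) : L2R) = mulOp f (𝓕 ψ) :=
  (Lp.fourierTransformₗᵢ ℝ ℂ).apply_symm_apply _

theorem fourier_U_symm (ψ : L2R) : (𝓕 ((waveletRep N).U.symm ψ) : L2R) =ᵐ[volume]
    fun ξ : ℝ => (((√(N : ℝ))⁻¹ : ℝ) : ℂ) * (𝓕 ψ : L2R) (ξ / N) := by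
  have h0 : (0 : ℝ) < N := Nat.cast_pos.2 (by have := hN.prop; omega)
  have h1 : (𝓕 ((waveletRep N).U.symm ψ) : L2R)
      = (dilation (N : ℝ)⁻¹ (inv_pos.2 h0)).symm (𝓕 ψ) := by
    rw [LinearIsometryEquiv.eq_symm_apply, ← fourier_dilation]
    congr 1
    exact (waveletRep N).U.apply_symm_apply ψ
  have h2 := coeFn_dilFun (N : ℝ)⁻¹⁻¹ (inv_pos.2 (inv_pos.2 h0)) (𝓕 ψ)
  rw [h1]
  filter_upwards [h2] with ξ h
  refine Eq.trans h ?_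
  rw [inv_inv]

theorem fourier_U_symm_iterate (ψ : L2R) (n : ℕ) :
    (𝓕 ((waveletRep N).U.symm^[n] ψ) : L2R) =ᵐ[volume]
      fun ξ : ℝ => (((√(N : ℝ))⁻¹ ^ n : ℝ) : ℂ) * (𝓕 ψ : L2R) (ξ / (N : ℝ) ^ n) := by
  have h0 : (0 : ℝ) < N := Nat.cast_pos.2 (by have := hN.prop; omega)
  induction n with
  | zero => simp
  | succ n ih =>
    rw [Function.iterate_succ_apply']
    filter_upwards [fourier_U_symm (N := N) ((waveletRep N).U.symm^[n] ψ),
      (qmp_div (N : ℝ) h0).ae ih] with ξ h1 h2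
    rw [h1, h2, div_div, pow_succ' (N : ℝ), pow_succ']
    push_cast
    ring

/-- Conjugation by Uⁿ rescales translation by k to translation by k/Nⁿ, so every invariant subspace
is stable under N-adic translations. -/
theorem fourier_conj_monomial (ψ : L2R) (n : ℕ) (k : ℤ) :
    (𝓕 ((waveletRep N).U.symm^[n] ((waveletRep N).π (monomial k) ((waveletRep N).U^[n] ψ))) : L2R)
      =ᵐ[volume] fun ξ : ℝ =>
        Complex.exp (2 * Real.pi * Complex.I * k * (-(ξ / (N : ℝ) ^ n) : ℝ)) * (𝓕 ψ : L2R) ξ := by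
  have h0 : (0 : ℝ) < N := Nat.cast_pos.2 (by have := hN.prop; omega)
  induction n generalizing ψ with
  | zero =>
    simp only [Function.iterate_zero, id, fourier_π]
    filter_upwards [coeFn_mulOp (monomial k) (𝓕 ψ), qmp_neg_mk.ae (coeFn_monomial k)] with ξ h1 h2
    rw [h1, h2, fourier_coe_apply]
    simp
  | succ n ih =>
    rw [Function.iterate_succ_apply', Function.iterate_succ_apply]
    have h3 := fourier_U_symm (N := N) ((waveletRep N).U ψ)
    rw [LinearIsometryEquiv.symm_apply_apply] at h3
    filter_upwards [fourier_U_symm (N := N) ((waveletRep N).U.symm^[n]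
        ((waveletRep N).π (monomial k) ((waveletRep N).U^[n] ((waveletRep N).U ψ)))),
      (qmp_div (N : ℝ) h0).ae (ih ((waveletRep N).U ψ)), h3] with ξ h1 h2 h3
    rw [h1, h2, h3, div_div, pow_succ' (N : ℝ)]
    ring

/-- Density of the N-adic rationals, in the form needed to extend a vanishing statement by
continuity. -/
theorem tendsto_floor_mul_pow_div (x : ℝ) :
    Tendsto (fun n : ℕ => (⌊x * (N : ℝ) ^ n⌋ : ℝ) / (N : ℝ) ^ n) atTop (𝓝 x) := by
  have h1 : (1 : ℝ) < N := by exact_mod_cast hN.prop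
  have hlim : Tendsto (fun n : ℕ => x - ((N : ℝ) ^ n)⁻¹) atTop (𝓝 x) := by
    simpa using (tendsto_inv_atTop_zero.comp (tendsto_pow_atTop_atTop_of_one_lt h1)).const_sub x
  refine tendsto_of_tendsto_of_tendsto_of_le_of_le hlim tendsto_const_nhds (fun n => ?_)
    fun n => ?_
  · have hp : (0 : ℝ) < (N : ℝ) ^ n := by positivity
    rw [le_div_iff₀ hp, sub_mul, inv_mul_cancel₀ hp.ne']
    exact (Int.sub_one_lt_floor _).le
  · have hp : (0 : ℝ) < (N : ℝ) ^ n := by positivity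
    exact (div_le_iff₀ hp).2 (Int.floor_le _)

/-- A vector whose Fourier transform tends to `1` along `N⁻ⁿξ` is cyclic for the wavelet
representation. -/
theorem isCyclicVector_waveletRep {φ : L2R}
    (hφ : ∀ᵐ ξ : ℝ, Tendsto (fun n : ℕ => (𝓕 φ : L2R) (ξ / (N : ℝ) ^ n)) atTop (𝓝 1)) :
    (waveletRep N).IsCyclicVector φ := by
  have h0 : (0 : ℝ) < N := Nat.cast_pos.2 (by have := hN.prop; omega)
  refine NormalRep.isCyclicVector_of_forall fun M hM hMc hφM => ?_
  have hMcomplete : CompleteSpace M := hMc.completeSpace_coe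
  rw [← Submodule.orthogonal_eq_bot_iff, eq_bot_iff]
  intro g hg
  rw [Submodule.mem_orthogonal] at hg
  have hUs : ∀ n : ℕ, ∀ x ∈ M, (waveletRep N).U.symm^[n] x ∈ M := by
    intro n x hx
    induction n with
    | zero => exact hx
    | succ n ih => rw [Function.iterate_succ_apply']; exact hM.U_symm_mem _ ih
  have hU : ∀ n : ℕ, ∀ x ∈ M, (waveletRep N).U^[n] x ∈ M := by
    intro n x hx
    induction n with
    | zero => exact hx
    | succ n ih => rw [Function.iterate_succ_apply']; exact hM.U_mem _ ih
  have hprod : ∀ ψ ∈ M, (fun ξ => inner ℂ ((𝓕 ψ : L2R) ξ) ((𝓕 g : L2R) ξ)) =ᵐ[volume] 0 := by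
    intro ψ hψ
    have hint : Integrable (fun ξ => inner ℂ ((𝓕 ψ : L2R) ξ) ((𝓕 g : L2R) ξ)) :=
      L2.integrable_inner (𝕜 := ℂ) (𝓕 ψ : L2R) (𝓕 g : L2R)
    -- The value of this Fourier transform at -k/Nⁿ is the inner product of g with the N-adic
    -- translate of ψ, which stays in M.
    have hz : ∀ (n : ℕ) (k : ℤ),
        𝓕 (fun ξ => inner ℂ ((𝓕 ψ : L2R) ξ) ((𝓕 g : L2R) ξ)) (-k / (N : ℝ) ^ n) = 0 := by
      intro n k
      have h1 := hg _ (hUs n _ (hM.π_mem (monomial k) _ (hU n ψ hψ)))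
      rw [← (Lp.fourierTransformₗᵢ ℝ ℂ).inner_map_map, L2.inner_def] at h1
      rw [Real.fourier_eq', ← h1]
      refine integral_congr_ae ?_
      filter_upwards [fourier_conj_monomial (N := N) ψ n k] with ξ h2
      change _ = inner ℂ ((𝓕 ((waveletRep N).U.symm^[n] ((waveletRep N).π (monomial k)
        ((waveletRep N).U^[n] ψ))) : L2R) ξ) ((𝓕 g : L2R) ξ)
      have h3 : Complex.exp (↑(-2 * Real.pi * inner ℝ ξ (-k / (N : ℝ) ^ n)) * Complex.I)
          = (starRingEnd ℂ)
            (Complex.exp (2 * Real.pi * Complex.I * k * (-(ξ / (N : ℝ) ^ n) : ℝ))) := by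
        rw [← Complex.exp_conj]
        congr 1
        simp only [RCLike.inner_apply, conj_trivial, map_mul, Complex.conj_ofReal, Complex.conj_I,
          map_ofNat, map_intCast]
        push_cast
        ring
      rw [h2, h3, RCLike.inner_apply, RCLike.inner_apply, map_mul, smul_eq_mul]
      ring
    refine ae_eq_zero_of_fourier_eq_zero hint fun x => ?_
    have hc : Continuous (𝓕 (fun ξ => inner ℂ ((𝓕 ψ : L2R) ξ) ((𝓕 g : L2R) ξ))) :=
      VectorFourier.fourierIntegral_continuous Real.continuous_fourierChar continuous_inner hint
    have hlim := (hc.tendsto x).comp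
      (by simpa using (tendsto_floor_mul_pow_div (N := N) (-x)).neg)
    refine tendsto_nhds_unique hlim ?_
    refine tendsto_const_nhds.congr fun n => ?_
    rw [Function.comp_apply, ← hz n ⌊-x * (N : ℝ) ^ n⌋, neg_div]
    simp
  -- Apply the vanishing product to U⁻ʲφ, whose transform is a nonzero multiple of φ̂(ξ/Nʲ).
  have hae : ∀ᵐ ξ : ℝ, ∀ j : ℕ, (𝓕 φ : L2R) (ξ / (N : ℝ) ^ j) = 0 ∨ (𝓕 g : L2R) ξ = 0 := by
    rw [ae_all_iff]
    intro j
    filter_upwards [hprod _ (hUs j φ hφM), fourier_U_symm_iterate (N := N) φ j] with ξ h1 h2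
    rw [h2] at h1
    have hs : ((√(N : ℝ) : ℝ) : ℂ) ≠ 0 := by
      rw [Complex.ofReal_ne_zero]; exact (Real.sqrt_pos.2 h0).ne'
    simpa [hs, or_comm] using h1
  have hG : (𝓕 g : L2R) = 0 := by
    rw [Lp.eq_zero_iff_ae_eq_zero]
    filter_upwards [hae, hφ] with ξ h1 h2
    by_contra h3
    have h4 : (fun n : ℕ => (𝓕 φ : L2R) (ξ / (N : ℝ) ^ n)) = fun _ => 0 :=
      funext fun n => (h1 n).resolve_right h3
    rw [h4] at h2
    exact zero_ne_one (tendsto_nhds_unique tendsto_const_nhds h2)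
  exact (map_eq_zero_iff _ (Lp.fourierTransformₗᵢ ℝ ℂ).injective).1 hG

end

/-! ### Unitary dilation of isometric representations -/

section iterate
variable (N : ℕ) [N.AtLeastTwo]

theorem compPow_iterate_add (k : ℕ) (f g : LInf) :
    (compPow N)^[k] (f + g) = (compPow N)^[k] f + (compPow N)^[k] g := by
  induction k with
  | zero => rfl
  | succ k ih => simp only [Function.iterate_succ_apply', ih, compPow_add]

theorem compPow_iterate_smul (k : ℕ) (c : ℂ) (f : LInf) :
    (compPow N)^[k] (c • f) = c • (compPow N)^[k] f := by
  induction k with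
  | zero => rfl
  | succ k ih => simp only [Function.iterate_succ_apply', ih, compPow_smul]

theorem compPow_iterate_mul (k : ℕ) (f g : LInf) :
    (compPow N)^[k] (f • g : LInf) = ((compPow N)^[k] f • (compPow N)^[k] g : LInf) := by
  induction k with
  | zero => rfl
  | succ k ih => simp only [Function.iterate_succ_apply', ih, compPow_mul]

theorem compPow_iterate_star (k : ℕ) (f : LInf) :
    (compPow N)^[k] (star f) = star ((compPow N)^[k] f) := by
  induction k with
  | zero => rfl
  | succ k ih => simp only [Function.iterate_succ_apply', ih, compPow_star]

theorem compPow_iterate_one (k : ℕ) :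
    (compPow N)^[k] (Lp.const ∞ volume (1 : ℂ)) = Lp.const ∞ volume (1 : ℂ) :=
  Function.iterate_fixed (compPow_one N) k

theorem norm_compPow_iterate (k : ℕ) (f : LInf) : ‖(compPow N)^[k] f‖ = ‖f‖ := by
  induction k with
  | zero => rfl
  | succ k ih => rw [Function.iterate_succ_apply', norm_compPow, ih]

end iterate

/-- A normal `*`-representation of `L^∞(𝕋)` together with an isometry `S` such that
`S π(f) = π(f(z ^ N)) S`. -/
structure IsometricRep (N : ℕ) [N.AtLeastTwo] (H : Type*) [NormedAddCommGroup H]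
    [InnerProductSpace ℂ H] [CompleteSpace H] where
  π : LInf →ₗ[ℂ] (H →L[ℂ] H)
  S : H →ₗᵢ[ℂ] H
  π_one : π (Lp.const ∞ volume (1 : ℂ)) = 1
  π_mul : ∀ f g : LInf, π (f • g : LInf) = π f * π g
  π_star : ∀ f : LInf, π (star f) = ContinuousLinearMap.adjoint (π f)
  norm_π_le : ∀ (f : LInf) (x : H), ‖π f x‖ ≤ ‖f‖ * ‖x‖
  covariance : ∀ (f : LInf) (x : H), S (π f x) = π (compPow N f) (S x)
  normal : ∀ x : H, ∃ m : Measure Circ, IsFiniteMeasure m ∧ m ≪ volume ∧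
    ∀ f : LInf, inner ℂ x (π f x) = ∫ t, f t ∂m

theorem integrable_of_ac (f : LInf) (m : Measure Circ) [IsFiniteMeasure m] (hm : m ≪ volume) :
    Integrable f m := by
  exact Integrable.of_bound ((Lp.aestronglyMeasurable f).mono_ac hm) ‖f‖ (hm.ae_le (ae_norm_le f))

/-- Push m forward under z ↦ z^N, k times. Measures rather than densities are carried along because
countably many of them will be summed. -/
theorem exists_measure_compPow_iterate (N : ℕ) [N.AtLeastTwo] (k : ℕ) (m : Measure Circ)
    [IsFiniteMeasure m] (hm : m ≪ volume) : ∃ m' : Measure Circ, IsFiniteMeasure m' ∧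
      m' ≪ volume ∧ ∀ f : LInf, ∫ t, (compPow N)^[k] f t ∂m = ∫ t, f t ∂m' := by
  induction k with
  | zero => exact ⟨m, inferInstance, hm, fun f => rfl⟩
  | succ k ih =>
    obtain ⟨m', _, hm', h⟩ := ih
    have hq := (measurePreserving_pow N)
    have hac : m'.map (fun t : Circ => N • t) ≪ volume :=
      (hm'.map hq.measurable).trans hq.quasiMeasurePreserving.absolutelyContinuous
    refine ⟨m'.map fun t : Circ => N • t, inferInstance, hac, fun f => ?_⟩
    rw [Function.iterate_succ_apply, h,
      integral_map hq.measurable.aemeasurable ((Lp.aestronglyMeasurable f).mono_ac hac)]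
    exact integral_congr_ae (hm'.ae_le (coeFn_compPow N f))

theorem exists_density_of_measure (m : Measure Circ) [IsFiniteMeasure m] (hm : m ≪ volume) :
    ∃ k : Circ → ℝ, Integrable k ∧ ∀ f : LInf, ∫ t, f t ∂m = ∫ t, f t * (k t : ℂ) := by
  refine ⟨fun t => (m.rnDeriv volume t).toReal, Measure.integrable_toReal_rnDeriv, fun f => ?_⟩
  rw [← integral_rnDeriv_smul hm]
  exact integral_congr_ae (Eventually.of_forall fun t => by simp only [Complex.real_smul]; ring)

theorem hasSum_l2_norm_sq {E : Type*} [NormedAddCommGroup E] (v : lp (fun _ : ℕ => E) 2) :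
    HasSum (fun k => ‖v k‖ ^ 2) (‖v‖ ^ 2) := by
  have h := lp.hasSum_norm (p := 2) (by simp) v
  simpa using h

theorem memℓp_two_of_summable {E : Type*} [NormedAddCommGroup E] {v : ℕ → E}
    (h : Summable fun k => ‖v k‖ ^ 2) : Memℓp v 2 :=
  memℓp_gen (by simpa using h)

namespace IsometricRep

variable {N : ℕ} [N.AtLeastTwo] {H : Type*} [NormedAddCommGroup H] [InnerProductSpace ℂ H]
  [CompleteSpace H] (R : IsometricRep N H)

/-- The adjoint of the isometry. -/
noncomputable def Sadj : H →L[ℂ] H := ContinuousLinearMap.adjoint R.S.toContinuousLinearMap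

theorem inner_Sadj_right (x y : H) : inner ℂ x (R.Sadj y) = inner ℂ (R.S x) y :=
  ContinuousLinearMap.adjoint_inner_right _ _ _

theorem Sadj_S (x : H) : R.Sadj (R.S x) = x := by
  refine ext_inner_left ℂ fun y => ?_
  rw [inner_Sadj_right, LinearIsometry.inner_map_map]

theorem inner_π_left (f : LInf) (x y : H) : inner ℂ (R.π f x) y = inner ℂ x (R.π (star f) y) := by
  rw [R.π_star, ContinuousLinearMap.adjoint_inner_right]

/-- The adjoint of the covariance relation. It shows that π(f(z^N)) preserves ker S*, so the
diagonal operators act on the dilation space. -/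
theorem Sadj_π_compPow (f : LInf) (x : H) :
    R.Sadj (R.π (compPow N f) x) = R.π f (R.Sadj x) := by
  refine ext_inner_left ℂ fun y => ?_
  rw [inner_Sadj_right, ← star_star f, compPow_star, ← inner_π_left, ← covariance,
    ← inner_π_left, inner_Sadj_right]

/-- The space of the unitary dilation. -/
def dilationSpace : Submodule ℂ (lp (fun _ : ℕ => H) 2) where
  -- Component 0 is free in H and all later ones lie in ker S*: this is H ⊕ ℓ²(ker S*).
  carrier := {v | ∀ k, R.Sadj (v (k + 1)) = 0}
  zero_mem' k := map_zero R.Sadj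
  add_mem' {v w} hv hw k := by
    change R.Sadj (v (k + 1) + w (k + 1)) = 0
    rw [map_add, hv k, hw k, add_zero]
  smul_mem' c v hv k := by
    change R.Sadj (c • v (k + 1)) = 0
    rw [map_smul, hv k, smul_zero]

theorem isClosed_dilationSpace : IsClosed (R.dilationSpace : Set (lp (fun _ : ℕ => H) 2)) := by
  have : (R.dilationSpace : Set (lp (fun _ : ℕ => H) 2)) = ⋂ k : ℕ,
      {v | R.Sadj (lp.evalCLM (𝕜 := ℂ) (E := fun _ : ℕ => H) (p := 2) (k + 1) v) = 0} := by
    ext v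
    simp only [Set.mem_iInter]
    rfl
  rw [this]
  exact isClosed_iInter fun k => isClosed_eq (by fun_prop) continuous_const

instance : CompleteSpace R.dilationSpace := R.isClosed_dilationSpace.completeSpace_coe

variable {R}

theorem dilationSpace_ext {v w : R.dilationSpace}
    (h : ∀ k, (v : lp (fun _ : ℕ => H) 2) k = (w : lp (fun _ : ℕ => H) 2) k) : v = w :=
  Subtype.ext (lp.ext (funext h))

variable (R)

/-- A vector of the dilation space from its components. -/
def mkVec (v : ℕ → H) (hs : Summable fun k => ‖v k‖ ^ 2) (h : ∀ k, R.Sadj (v (k + 1)) = 0) :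
    R.dilationSpace :=
  ⟨⟨v, memℓp_two_of_summable hs⟩, h⟩

theorem summable_vec (v : R.dilationSpace) :
    Summable fun k => ‖(v : lp (fun _ : ℕ => H) 2) k‖ ^ 2 :=
  (hasSum_l2_norm_sq (v : lp (fun _ : ℕ => H) 2)).summable

theorem hasSum_vec (v : R.dilationSpace) :
    HasSum (fun k => ‖(v : lp (fun _ : ℕ => H) 2) k‖ ^ 2) (‖v‖ ^ 2) :=
  hasSum_l2_norm_sq (v : lp (fun _ : ℕ => H) 2)

theorem norm_π_iterate_sq_le (f : LInf) (k : ℕ) (x : H) :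
    ‖R.π ((compPow N)^[k] f) x‖ ^ 2 ≤ ‖f‖ ^ 2 * ‖x‖ ^ 2 := by
  rw [← mul_pow]
  gcongr
  exact (R.norm_π_le _ _).trans_eq (by rw [norm_compPow_iterate])

/-- The diagonal operator `(π(f)v)ₖ = π(f(z ^ (N ^ k))) vₖ` on the dilation space. -/
noncomputable def dilationOp (f : LInf) (v : R.dilationSpace) : R.dilationSpace :=
  R.mkVec (fun k => R.π ((compPow N)^[k] f) ((v : lp (fun _ : ℕ => H) 2) k))
    (((R.summable_vec v).mul_left (‖f‖ ^ 2)).of_nonneg_of_le (fun k => by positivity)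
      fun k => R.norm_π_iterate_sq_le f k _)
    (fun k => by rw [Function.iterate_succ_apply', Sadj_π_compPow, v.2 k, map_zero])

theorem dilationOp_apply (f : LInf) (v : R.dilationSpace) (k : ℕ) :
    (R.dilationOp f v : lp (fun _ : ℕ => H) 2) k
      = R.π ((compPow N)^[k] f) ((v : lp (fun _ : ℕ => H) 2) k) := rfl

theorem coe_add_apply (v w : R.dilationSpace) (k : ℕ) :
    ((v + w : R.dilationSpace) : lp (fun _ : ℕ => H) 2) k
      = (v : lp (fun _ : ℕ => H) 2) k + (w : lp (fun _ : ℕ => H) 2) k := rfl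

theorem coe_smul_apply (c : ℂ) (v : R.dilationSpace) (k : ℕ) :
    ((c • v : R.dilationSpace) : lp (fun _ : ℕ => H) 2) k
      = c • (v : lp (fun _ : ℕ => H) 2) k := rfl

theorem norm_dilationOp_le (f : LInf) (v : R.dilationSpace) :
    ‖R.dilationOp f v‖ ≤ ‖f‖ * ‖v‖ := by
  rw [← sq_le_sq₀ (norm_nonneg _) (by positivity), mul_pow]
  refine hasSum_le (fun k => ?_) (R.hasSum_vec _) ((R.hasSum_vec v).mul_left _)
  rw [dilationOp_apply]
  exact R.norm_π_iterate_sq_le f k _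

theorem dilationOp_map_add (f : LInf) (v w : R.dilationSpace) :
    R.dilationOp f (v + w) = R.dilationOp f v + R.dilationOp f w :=
  dilationSpace_ext fun k => by simp only [dilationOp_apply, coe_add_apply, map_add]

theorem dilationOp_map_smul (f : LInf) (c : ℂ) (v : R.dilationSpace) :
    R.dilationOp f (c • v) = c • R.dilationOp f v :=
  dilationSpace_ext fun k => by simp only [dilationOp_apply, coe_smul_apply, map_smul]

/-- The diagonal representation of `L^∞(𝕋)` on the dilation space. -/
noncomputable def dilationπ : LInf →ₗ[ℂ] (R.dilationSpace →L[ℂ] R.dilationSpace) where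
  toFun f := LinearMap.mkContinuous
    { toFun := R.dilationOp f
      map_add' := R.dilationOp_map_add f
      map_smul' := R.dilationOp_map_smul f } ‖f‖ (R.norm_dilationOp_le f)
  map_add' f g := by
    ext1 v
    change R.dilationOp (f + g) v = R.dilationOp f v + R.dilationOp g v
    refine dilationSpace_ext fun k => ?_
    simp only [dilationOp_apply, coe_add_apply, compPow_iterate_add, map_add, add_apply]
  map_smul' c f := by
    ext1 v
    change R.dilationOp (c • f) v = c • R.dilationOp f v
    refine dilationSpace_ext fun k => ?_
    simp only [dilationOp_apply, coe_smul_apply, compPow_iterate_smul, map_smul, smul_apply]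

theorem dilationπ_apply (f : LInf) (v : R.dilationSpace) (k : ℕ) :
    (R.dilationπ f v : lp (fun _ : ℕ => H) 2) k
      = R.π ((compPow N)^[k] f) ((v : lp (fun _ : ℕ => H) 2) k) := rfl

/-- The components of `Uv`. -/
noncomputable def shiftFun (v : ℕ → H) : ℕ → H
  -- The copies of ker S* move down one place, and the first of them fills the orthogonal complement
  -- of the range of S in H.
  | 0 => R.S (v 0) + v 1
  | k + 1 => v (k + 2)

/-- The components of `U⁻¹v`. -/
noncomputable def unshiftFun (v : ℕ → H) : ℕ → H
  | 0 => R.Sadj (v 0)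
  -- The projection of v 0 to ker S*, which U⁻¹ sends up into the first copy.
  | 1 => v 0 - R.S (R.Sadj (v 0))
  | k + 2 => v (k + 1)

theorem summable_shiftFun (v : R.dilationSpace) :
    Summable fun k => ‖R.shiftFun (v : lp (fun _ : ℕ => H) 2) k‖ ^ 2 :=
  (summable_nat_add_iff 1).1 ((summable_nat_add_iff 2).2 (R.summable_vec v))

theorem summable_unshiftFun (v : R.dilationSpace) :
    Summable fun k => ‖R.unshiftFun (v : lp (fun _ : ℕ => H) 2) k‖ ^ 2 :=
  (summable_nat_add_iff 2).1 ((summable_nat_add_iff 1).2 (R.summable_vec v))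

/-- The unitary operator of the dilation. -/
noncomputable def dilationU : R.dilationSpace ≃ₗᵢ[ℂ] R.dilationSpace where
  toFun v := R.mkVec (R.shiftFun (v : lp (fun _ : ℕ => H) 2)) (R.summable_shiftFun v)
    fun k => v.2 (k + 1)
  invFun v := R.mkVec (R.unshiftFun (v : lp (fun _ : ℕ => H) 2)) (R.summable_unshiftFun v)
    fun k => by
      cases k with
      | zero =>
        change R.Sadj (_ - R.S (R.Sadj _)) = 0
        rw [map_sub, Sadj_S, sub_self]
      | succ k => exact v.2 k
  left_inv v := dilationSpace_ext fun k => by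
    have h : R.Sadj (R.S ((v : lp (fun _ : ℕ => H) 2) 0) + (v : lp (fun _ : ℕ => H) 2) 1)
        = (v : lp (fun _ : ℕ => H) 2) 0 := by
      rw [map_add, Sadj_S, v.2 0, add_zero]
    match k with
    | 0 => exact h
    | 1 =>
      change R.S _ + _ - R.S (R.Sadj (R.S _ + _)) = _
      rw [h, add_sub_cancel_left]
    | k + 2 => rfl
  right_inv v := dilationSpace_ext fun k => by
    match k with
    | 0 => exact add_sub_cancel _ _
    | k + 1 => rfl
  map_add' v w := dilationSpace_ext fun k => by
    match k with
    | 0 =>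
      change R.S (_ + _) + (_ + _) = (R.S _ + _) + (R.S _ + _)
      rw [map_add]
      abel
    | k + 1 => rfl
  map_smul' c v := dilationSpace_ext fun k => by
    match k with
    | 0 =>
      change R.S (c • _) + c • _ = c • (R.S _ + _)
      rw [map_smul, smul_add]
    | k + 1 => rfl
  norm_map' v := by
    rw [← sq_eq_sq₀ (norm_nonneg _) (norm_nonneg _)]
    refine (R.hasSum_vec _).unique ?_
    -- The tail of Uv from index 1 is the tail of v from index 2, so it remains to see ‖S v₀ + v₁‖²
    -- = ‖v₀‖² + ‖v₁‖²; this is Pythagoras, as S* v₁ = 0.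
    have h1 := (hasSum_nat_add_iff' 2).2 (R.hasSum_vec v)
    refine (hasSum_nat_add_iff' 1).1 ?_
    convert! h1 using 1
    have h2 : inner ℂ (R.S ((v : lp (fun _ : ℕ => H) 2) 0)) ((v : lp (fun _ : ℕ => H) 2) 1) = 0 := by
      rw [← inner_Sadj_right, v.2 0, inner_zero_right]
    have h3 := norm_add_sq_eq_norm_sq_add_norm_sq_of_inner_eq_zero _ _ h2
    rw [LinearIsometry.norm_map] at h3
    rw [Finset.sum_range_one, Finset.sum_range_succ, Finset.sum_range_one]
    change _ - ‖R.S _ + _‖ ^ 2 = _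
    rw [sq ‖R.S _ + _‖, h3]
    ring

/-- The unitary dilation of an isometric representation. -/
noncomputable def dilationRep : NormalRep N R.dilationSpace where
  π := R.dilationπ
  U := R.dilationU
  π_one := by
    ext1 v
    refine dilationSpace_ext fun k => ?_
    rw [dilationπ_apply, compPow_iterate_one, π_one]
    rfl
  π_mul f g := by
    ext1 v
    refine dilationSpace_ext fun k => ?_
    rw [dilationπ_apply, compPow_iterate_mul, π_mul]
    rfl
  π_star f := by
    rw [ContinuousLinearMap.eq_adjoint_iff]
    intro v w
    change inner ℂ (R.dilationπ (star f) v : lp (fun _ : ℕ => H) 2) (w : lp (fun _ : ℕ => H) 2)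
      = inner ℂ (v : lp (fun _ : ℕ => H) 2) (R.dilationπ f w : lp (fun _ : ℕ => H) 2)
    rw [lp.inner_eq_tsum, lp.inner_eq_tsum]
    refine tsum_congr fun k => ?_
    rw [dilationπ_apply, dilationπ_apply, inner_π_left, compPow_iterate_star, star_star]
  covariance f v := by
    rw [← R.dilationU.apply_symm_apply v, LinearIsometryEquiv.symm_apply_apply]
    refine dilationSpace_ext fun k => ?_
    -- After writing v as U of another vector: beyond component 0, U lowers the index by one, which
    -- matches the extra factor N in the exponent of f(z^(N^k)). Component 0 is the covariance of S.
    match k with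
    | 0 =>
      change R.S (R.π f _) + R.π (compPow N f) _ = R.π (compPow N f) (R.S _ + _)
      rw [map_add, covariance]
    | k + 1 => rfl
  normal v := by
    have h1 : ∀ k : ℕ, ∃ m : Measure Circ, IsFiniteMeasure m ∧ m ≪ volume ∧
        ∀ f : LInf, inner ℂ ((v : lp (fun _ : ℕ => H) 2) k)
          (R.π ((compPow N)^[k] f) ((v : lp (fun _ : ℕ => H) 2) k)) = ∫ t, f t ∂m := by
      intro k
      obtain ⟨m, _, hm, h⟩ := R.normal ((v : lp (fun _ : ℕ => H) 2) k)
      obtain ⟨m', hm'1, hm'2, h'⟩ := exists_measure_compPow_iterate N k m hm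
      exact ⟨m', hm'1, hm'2, fun f => by rw [h, h']⟩
    choose m hmf hm h using h1
    have hmass : ∀ k, (m k).real Set.univ = ‖(v : lp (fun _ : ℕ => H) 2) k‖ ^ 2 := by
      intro k
      have h2 := h k (Lp.const ∞ volume (1 : ℂ))
      rw [compPow_iterate_one, π_one, one_apply_eq_self, inner_self_eq_norm_sq_to_K,
        integral_congr_ae ((hm k).ae_le
          (Lp.coeFn_const (p := ∞) (μ := (volume : Measure Circ)) (1 : ℂ)))] at h2
      simp only [Function.const_apply, integral_const, Complex.real_smul, mul_one] at h2
      exact Complex.ofReal_injective (by rw [← h2]; simp)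
    -- The state of v is the sum of the states of its components, whose masses ‖v k‖² are summable.
    have hfin : IsFiniteMeasure (Measure.sum m) := by
      refine ⟨?_⟩
      rw [Measure.sum_apply _ MeasurableSet.univ]
      have h3 : ∀ k, m k Set.univ = ENNReal.ofReal (‖(v : lp (fun _ : ℕ => H) 2) k‖ ^ 2) :=
        fun k => by rw [← hmass, ofReal_measureReal]
      simp_rw [h3]
      rw [← ENNReal.ofReal_tsum_of_nonneg (fun k => by positivity) (R.summable_vec v)]
      exact ENNReal.ofReal_lt_top
    have hac : Measure.sum m ≪ volume := Measure.absolutelyContinuous_sum_left hm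
    obtain ⟨d, hd, hd'⟩ := exists_density_of_measure (Measure.sum m) hac
    refine ⟨d, hd, fun f => ?_⟩
    rw [← hd']
    refine (lp.hasSum_inner (v : lp (fun _ : ℕ => H) 2)
      (R.dilationπ f v : lp (fun _ : ℕ => H) 2)).unique ?_
    simp only [dilationπ_apply, h]
    exact hasSum_integral_measure (integrable_of_ac f _ hac)

/-- The inclusion of the space of the isometric representation into the dilation space. -/
def inclusion (x : H) : R.dilationSpace :=
  R.mkVec (fun k => k.casesOn x fun _ => 0)
    ((summable_nat_add_iff 1).1 (by simp)) fun k => map_zero R.Sadj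

theorem dilationRep_π_inclusion (f : LInf) (x : H) :
    R.dilationRep.π f (R.inclusion x) = R.inclusion (R.π f x) :=
  dilationSpace_ext fun k => by
    match k with
    | 0 => rfl
    | k + 1 => exact map_zero _

theorem dilationRep_U_inclusion (x : H) :
    R.dilationRep.U (R.inclusion x) = R.inclusion (R.S x) :=
  dilationSpace_ext fun k => by
    match k with
    | 0 => exact add_zero _
    | k + 1 => rfl

theorem inner_inclusion (x y : H) :
    inner ℂ (R.inclusion x) (R.inclusion y) = inner ℂ x y := by
  change inner ℂ (R.inclusion x : lp (fun _ : ℕ => H) 2) (R.inclusion y : lp (fun _ : ℕ => H) 2) = _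
  rw [lp.inner_eq_tsum, tsum_eq_single 0]
  · rfl
  · intro k hk
    obtain ⟨k, rfl⟩ := Nat.exists_eq_succ_of_ne_zero hk
    exact inner_zero_left _

end IsometricRep
/-! ### The isometric representation on `L²(𝕋, ν)` -/

section L2
variable {ν : Measure Circ}

theorem memLp_of_ac (hν : ν ≪ volume) (f : LInf) : MemLp f ∞ ν :=
  memLp_top_of_bound ((Lp.aestronglyMeasurable f).mono_ac hν) ‖f‖ (hν.ae_le (ae_norm_le f))

/-- Multiplication by `f` on `L²(𝕋, ν)`. -/
noncomputable def circMul (hν : ν ≪ volume) (f : LInf) : Lp ℂ 2 ν →L[ℂ] Lp ℂ 2 ν :=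
  (ContinuousLinearMap.mul ℂ ℂ).holderL ν ∞ 2 2 (memLp_of_ac hν f).toLp

theorem coeFn_circMul (hν : ν ≪ volume) (f : LInf) (g : Lp ℂ 2 ν) :
    circMul hν f g =ᵐ[ν] fun t => f t * g t := by
  have h := (ContinuousLinearMap.mul ℂ ℂ).coeFn_holder (r := 2) (memLp_of_ac hν f).toLp g
  filter_upwards [h, (memLp_of_ac hν f).coeFn_toLp] with x h1 h2
  rw [← h2]
  exact h1

/-- The representation of `L^∞(𝕋)` on `L²(𝕋, ν)` by multiplication operators. -/
noncomputable def circMulₗ (hν : ν ≪ volume) : LInf →ₗ[ℂ] (Lp ℂ 2 ν →L[ℂ] Lp ℂ 2 ν) where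
  toFun := circMul hν
  map_add' f g := by
    ext1 ψ
    apply Lp.ext
    filter_upwards [coeFn_circMul hν (f + g) ψ, coeFn_circMul hν f ψ, coeFn_circMul hν g ψ,
      Lp.coeFn_add (circMul hν f ψ) (circMul hν g ψ), hν.ae_le (Lp.coeFn_add f g)]
      with x h1 h2 h3 h4 h5
    rw [add_apply, h1, h4, Pi.add_apply, h2, h3, h5, Pi.add_apply, add_mul]
  map_smul' c f := by
    ext1 ψ
    apply Lp.ext
    filter_upwards [coeFn_circMul hν (c • f) ψ, coeFn_circMul hν f ψ,
      Lp.coeFn_smul c (circMul hν f ψ), hν.ae_le (Lp.coeFn_smul c f)] with x h1 h2 h4 h5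
    rw [RingHom.id_apply, smul_apply, h1, h4, Pi.smul_apply, h2, h5, Pi.smul_apply, smul_eq_mul,
      smul_eq_mul, mul_assoc]

theorem circMul_one (hν : ν ≪ volume) : circMul hν (Lp.const ∞ volume (1 : ℂ)) = 1 := by
  ext1 ψ
  apply Lp.ext
  filter_upwards [coeFn_circMul hν (Lp.const ∞ volume (1 : ℂ)) ψ,
    hν.ae_le (Lp.coeFn_const (p := ∞) (μ := (volume : Measure Circ)) (1 : ℂ))] with x h1 h2
  rw [h1, h2, Function.const_apply, one_mul, one_apply_eq_self]

theorem circMul_mul (hν : ν ≪ volume) (f g : LInf) :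
    circMul hν (f • g : LInf) = circMul hν f * circMul hν g := by
  ext1 ψ
  apply Lp.ext
  filter_upwards [coeFn_circMul hν (f • g : LInf) ψ, coeFn_circMul hν f (circMul hν g ψ),
    coeFn_circMul hν g ψ, hν.ae_le (Lp.coeFn_lpSMul (r := ∞) f g)] with x h1 h2 h3 h4
  rw [mul_apply_eq_comp, h1, h2, h3, h4, Pi.smul_apply', smul_eq_mul, mul_assoc]

theorem circMul_star (hν : ν ≪ volume) (f : LInf) :
    circMul hν (star f) = ContinuousLinearMap.adjoint (circMul hν f) := by
  rw [ContinuousLinearMap.eq_adjoint_iff]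
  intro ψ χ
  rw [L2.inner_def, L2.inner_def]
  refine integral_congr_ae ?_
  filter_upwards [coeFn_circMul hν (star f) ψ, coeFn_circMul hν f χ, hν.ae_le (Lp.coeFn_star f)]
    with x h1 h2 h3
  rw [h1, h2, h3, Pi.star_apply, RCLike.inner_apply, RCLike.inner_apply, map_mul,
    RCLike.star_def, RCLike.conj_conj]
  ring

theorem norm_circMul_le (hν : ν ≪ volume) (f : LInf) (g : Lp ℂ 2 ν) :
    ‖circMul hν f g‖ ≤ ‖f‖ * ‖g‖ := by
  refine Lp.norm_le_mul_norm_of_ae_le_mul ?_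
  filter_upwards [coeFn_circMul hν f g, hν.ae_le (ae_norm_le f)] with t h1 h2
  rw [h1, norm_mul]
  gcongr

theorem circMul_normal (hν : ν ≪ volume) (χ : Lp ℂ 2 ν) :
    ∃ m : Measure Circ, IsFiniteMeasure m ∧ m ≪ volume ∧
      ∀ f : LInf, inner ℂ χ (circMul hν f χ) = ∫ t, f t ∂m := by
  have hmeas : AEMeasurable (fun ξ => ‖χ ξ‖ₑ ^ 2) ν :=
    (Lp.aestronglyMeasurable χ).enorm.pow_const 2
  have hfin : ∫⁻ ξ, ‖χ ξ‖ₑ ^ 2 ∂ν ≠ ∞ := by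
    have h := (eLpNorm_lt_top_iff_lintegral_rpow_enorm_lt_top (by norm_num) (by norm_num)).1
      (Lp.memLp χ).2
    simpa using h.ne
  refine ⟨ν.withDensity fun ξ => ‖χ ξ‖ₑ ^ 2, isFiniteMeasure_withDensity hfin,
    (withDensity_absolutelyContinuous _ _).trans hν, fun f => ?_⟩
  rw [integral_withDensity_eq_integral_toReal_smul₀ hmeas
      (Eventually.of_forall fun ξ => by finiteness), L2.inner_def]
  refine integral_congr_ae ?_
  filter_upwards [coeFn_circMul hν f χ] with ξ h
  rw [h, RCLike.inner_apply, mul_assoc, RCLike.mul_conj, Complex.real_smul]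
  simp [mul_comm]

variable {N : ℕ} [N.AtLeastTwo] {m : LInf}

/-- The map `z ↦ z ^ N` transports the measure `|m|² ν` to `ν`. -/
def IsHarmonicMeasure (N : ℕ) [N.AtLeastTwo] (m : LInf) (ν : Measure Circ) : Prop :=
  MeasurePreserving (fun t : Circ => N • t) (ν.withDensity fun t => ‖m t‖ₑ ^ 2) ν

/-- The measure being transported is |m|² ν, so ν-null sets pull back to null sets only where m ≠ 0.
This is enough, since g(z^N) occurs only with the factor m. -/
theorem IsHarmonicMeasure.ae (hq : IsHarmonicMeasure N m ν) {p : Circ → Prop}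
    (hp : ∀ᵐ t ∂ν, p t) : ∀ᵐ t ∂ν, m t ≠ 0 → p (N • t) := by
  have h1 := hq.quasiMeasurePreserving.ae hp
  rw [ae_withDensity_iff ((Lp.stronglyMeasurable m).measurable.enorm.pow_const 2)] at h1
  filter_upwards [h1] with t ht hm
  exact ht (by simpa using hm)

/-- Change of variables: ∫ |m|² |g(z^N)|² dν = ∫ |g|² dν. -/
theorem IsHarmonicMeasure.eLpNorm_eq (hq : IsHarmonicMeasure N m ν) (g : Lp ℂ 2 ν) :
    eLpNorm (fun t => m t * g (N • t)) 2 ν = eLpNorm g 2 ν := by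
  have hm2 : Measurable fun t => ‖m t‖ₑ ^ 2 :=
    (Lp.stronglyMeasurable m).measurable.enorm.pow_const 2
  have hg2 : Measurable fun t => ‖g t‖ₑ ^ 2 :=
    (Lp.stronglyMeasurable g).measurable.enorm.pow_const 2
  rw [eLpNorm_eq_lintegral_rpow_enorm_toReal (by norm_num) (by norm_num),
    eLpNorm_eq_lintegral_rpow_enorm_toReal (by norm_num) (by norm_num)]
  congr 1
  simp only [ENNReal.toReal_ofNat, ENNReal.rpow_ofNat, enorm_mul, mul_pow]
  rw [← hq.lintegral_comp hg2]
  exact (lintegral_withDensity_eq_lintegral_mul _ hm2 (hg2.comp hq.measurable)).symm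

theorem IsHarmonicMeasure.memLp (hq : IsHarmonicMeasure N m ν) (g : Lp ℂ 2 ν) :
    MemLp (fun t => m t * g (N • t)) 2 ν := by
  refine ⟨?_, ?_⟩
  · exact ((Lp.stronglyMeasurable m).mul
      ((Lp.stronglyMeasurable g).comp_measurable hq.measurable)).aestronglyMeasurable
  · rw [hq.eLpNorm_eq]
    exact Lp.eLpNorm_lt_top g

theorem IsHarmonicMeasure.coeFn_toLp (hq : IsHarmonicMeasure N m ν) (g : Lp ℂ 2 ν) :
    (hq.memLp g).toLp =ᵐ[ν] fun t => m t * g (N • t) := (hq.memLp g).coeFn_toLp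

/-- The isometry `g(z) ↦ m(z) g(z ^ N)` of `L²(𝕋, ν)`. -/
noncomputable def IsHarmonicMeasure.isometry (hq : IsHarmonicMeasure N m ν) :
    Lp ℂ 2 ν →ₗᵢ[ℂ] Lp ℂ 2 ν where
  toFun g := (hq.memLp g).toLp
  map_add' f g := by
    apply Lp.ext
    filter_upwards [hq.coeFn_toLp (f + g), hq.coeFn_toLp f, hq.coeFn_toLp g,
      Lp.coeFn_add (hq.memLp f).toLp (hq.memLp g).toLp, hq.ae (Lp.coeFn_add f g)]
      with t h1 h2 h3 h4 h5
    rw [h1, h4, Pi.add_apply, h2, h3, ← mul_add]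
    by_cases hm : m t = 0
    · rw [hm, zero_mul, zero_mul]
    · rw [h5 hm, Pi.add_apply]
  map_smul' c f := by
    apply Lp.ext
    filter_upwards [hq.coeFn_toLp (c • f), hq.coeFn_toLp f,
      Lp.coeFn_smul c (hq.memLp f).toLp, hq.ae (Lp.coeFn_smul c f)] with t h1 h2 h4 h5
    rw [RingHom.id_apply, h1, h4, Pi.smul_apply, h2, smul_eq_mul]
    by_cases hm : m t = 0
    · rw [hm, zero_mul, zero_mul, mul_zero]
    · rw [h5 hm, Pi.smul_apply, smul_eq_mul, mul_left_comm]
  norm_map' g := by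
    change ‖(hq.memLp g).toLp‖ = ‖g‖
    rw [Lp.norm_toLp, hq.eLpNorm_eq, Lp.norm_def]

/-- The isometric representation on `L²(𝕋, ν)`. -/
noncomputable def IsHarmonicMeasure.isometricRep (hq : IsHarmonicMeasure N m ν)
    (hν : ν ≪ volume) : IsometricRep N (Lp ℂ 2 ν) where
  π := circMulₗ hν
  S := hq.isometry
  π_one := circMul_one hν
  π_mul := circMul_mul hν
  π_star := circMul_star hν
  norm_π_le := norm_circMul_le hν
  covariance f g := by
    apply Lp.ext
    change (hq.memLp (circMul hν f g)).toLp =ᵐ[ν]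
      circMul hν (compPow N f) (hq.memLp g).toLp
    filter_upwards [hq.coeFn_toLp (circMul hν f g), hq.coeFn_toLp g,
      hq.ae (coeFn_circMul hν f g), coeFn_circMul hν (compPow N f) (hq.memLp g).toLp,
      hν.ae_le (coeFn_compPow N f)] with t h1 h2 h3 h4 h5
    rw [h1, h4, h2, h5]
    by_cases hm : m t = 0
    · rw [hm, zero_mul, zero_mul, mul_zero]
    · rw [h3 hm]
      ring
  normal := circMul_normal hν

/-- The representation of `𝔄_N` generated from a harmonic measure. -/
theorem IsHarmonicMeasure.exists_isInduced [IsFiniteMeasure ν] (hq : IsHarmonicMeasure N m ν)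
    (hν : ν ≪ volume) (h : Circ → ℝ)
    (hh : ∀ f : LInf, ∫ t, f t ∂ν = ∫ t, f t * (h t : ℂ)) :
    ∃ (H : Type) (_ : NormedAddCommGroup H) (_ : InnerProductSpace ℂ H) (_ : CompleteSpace H)
      (ρ : NormalRep N H) (Φ : H), ρ.IsInduced m h Φ := by
  let R := hq.isometricRep hν
  -- The generating vector is the constant 1: its state is integration against ν, and the isometry
  -- sends it to m.
  let e : Lp ℂ 2 ν := Lp.const 2 ν (1 : ℂ)
  have he : (e : Circ → ℂ) =ᵐ[ν] fun _ => 1 := Lp.coeFn_const (p := 2) (μ := ν) (1 : ℂ)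
  have hstate : ∀ f : LInf, inner ℂ (R.inclusion e) (R.dilationRep.π f (R.inclusion e))
      = ∫ t, f t * (h t : ℂ) := by
    intro f
    rw [R.dilationRep_π_inclusion, R.inner_inclusion, ← hh, L2.inner_def]
    refine integral_congr_ae ?_
    filter_upwards [coeFn_circMul hν f e, he] with t h1 h2
    change inner ℂ (e t) (circMul hν f e t) = _
    rw [h1, h2]
    simp
  have hscal : R.dilationRep.U (R.inclusion e) = R.dilationRep.π m (R.inclusion e) := by
    rw [R.dilationRep_π_inclusion, R.dilationRep_U_inclusion]
    congr 1
    apply Lp.ext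
    change (hq.memLp e).toLp =ᵐ[ν] circMul hν m e
    filter_upwards [hq.coeFn_toLp e, coeFn_circMul hν m e, he, hq.ae he] with t h1 h2 h3 h4
    rw [h1, h2, h3]
    by_cases hm : m t = 0
    · rw [hm, zero_mul, zero_mul]
    · rw [h4 hm]
  obtain ⟨M, hM, σ, y, hσ⟩ := NormalRep.exists_isInduced_restrict R.dilationRep m h _ hstate hscal
  exact ⟨M, inferInstance, inferInstance, hM, σ, y, hσ⟩

end L2
/-! ### The Ruelle operator -/

/-- The fibre of z ↦ z^N through t consists of the N distinct points t + k/N. Evaluating at N • t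
avoids choosing a root. -/
theorem ruelle_nsmul (N : ℕ) [hN : N.AtLeastTwo] (m₀ : Circ → ℂ) (f : Circ → ℝ) (t : Circ) :
    ruelle N m₀ f (N • t) = (N : ℝ)⁻¹ * ∑ k ∈ Finset.range N,
      ‖m₀ ((((k : ℝ) / N : ℝ) : Circ) + t)‖ ^ 2 * f ((((k : ℝ) / N : ℝ) : Circ) + t) := by
  have h0 : (0 : ℝ) < N := Nat.cast_pos.2 (by have := hN.prop; omega)
  have hset : {s : Circ | N • s = N • t}
      = ((Finset.range N).image fun k : ℕ => (((k : ℝ) / N : ℝ) : Circ) + t : Finset Circ) := by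
    ext s
    simp only [Set.mem_ofPred_eq, Finset.coe_image, Set.mem_image, Finset.coe_range, Set.mem_Iio]
    constructor
    · intro hs
      obtain ⟨x, hx⟩ := QuotientAddGroup.mk_surjective (s - t)
      have hx' : (x : Circ) = s - t := hx
      have h1 : ((N * x : ℝ) : Circ) = 0 := by
        rw [← nsmul_eq_mul, AddCircle.coe_nsmul, hx', nsmul_sub, hs, sub_self]
      obtain ⟨n, hn⟩ := (AddCircle.coe_eq_zero_iff (1 : ℝ)).1 h1
      have hNz : (N : ℤ) ≠ 0 := by exact_mod_cast h0.ne'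
      -- s - t is the class of x with N x = n an integer, so x = n/N, and only n mod N matters on
      -- the circle.
      refine ⟨(n % N).toNat, ?_, ?_⟩
      · have := Int.emod_lt_of_pos n (b := N) (by exact_mod_cast h0)
        have := Int.emod_nonneg n hNz
        omega
      · rw [← eq_sub_iff_add_eq, ← hx', ← sub_eq_zero, ← AddCircle.coe_sub,
          AddCircle.coe_eq_zero_iff]
        refine ⟨-(n / N), ?_⟩
        have h2 : (((n % N).toNat : ℕ) : ℝ) = ((n % N : ℤ) : ℝ) := by
          have := Int.toNat_of_nonneg (Int.emod_nonneg n hNz)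
          exact_mod_cast congrArg (Int.cast : ℤ → ℝ) this
        have h3 : ((n % N : ℤ) : ℝ) = n - N * ((n / N : ℤ) : ℝ) := by
          rw [Int.emod_def]; push_cast; ring
        rw [h2, h3]
        simp only [zsmul_eq_mul, mul_one] at hn ⊢
        push_cast
        field_simp
        linarith
    · rintro ⟨k, -, rfl⟩
      rw [nsmul_add, ← AddCircle.coe_nsmul, nsmul_eq_mul, mul_div_cancel₀ _ h0.ne']
      have : ((k : ℝ) : Circ) = 0 :=
        (AddCircle.coe_eq_zero_iff (1 : ℝ)).2 ⟨k, by simp⟩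
      rw [this, zero_add]
  have hinj : Set.InjOn (fun k : ℕ => (((k : ℝ) / N : ℝ) : Circ) + t) (Finset.range N) := by
    intro j hj k hk hjk
    have hmem : ∀ i ∈ Finset.range N, (i : ℝ) / N ∈ Set.Ico (0 : ℝ) (0 + 1) := by
      intro i hi
      refine ⟨by positivity, ?_⟩
      rw [zero_add, div_lt_one h0]
      exact_mod_cast Finset.mem_range.1 hi
    have h1 := (AddCircle.coe_eq_coe_iff_of_mem_Ico (hmem j hj) (hmem k hk)).1
      (add_right_cancel hjk)
    rw [div_left_inj' h0.ne'] at h1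
    exact_mod_cast h1
  rw [ruelle, hset, finsum_mem_coe_finset, Finset.sum_image hinj]

theorem sum_ofReal_eq_of_ruelle (N : ℕ) [hN : N.AtLeastTwo] {m₀ : Circ → ℂ} {h : Circ → ℝ}
    {t : Circ} (hnn : ∀ k : ℕ, 0 ≤ h ((((k : ℝ) / N : ℝ) : Circ) + t))
    (hR : ruelle N m₀ h (N • t) = h (N • t)) :
    ∑ k ∈ Finset.range N, ENNReal.ofReal (‖m₀ ((((k : ℝ) / N : ℝ) : Circ) + t)‖ ^ 2 *
      h ((((k : ℝ) / N : ℝ) : Circ) + t)) = N * ENNReal.ofReal (h (N • t)) := by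
  have h0 : (N : ℝ) ≠ 0 := Nat.cast_ne_zero.2 (by have := hN.prop; omega)
  have h1 : ∑ k ∈ Finset.range N, ‖m₀ ((((k : ℝ) / N : ℝ) : Circ) + t)‖ ^ 2 *
      h ((((k : ℝ) / N : ℝ) : Circ) + t) = N * h (N • t) := by
    rw [← hR, ruelle_nsmul, mul_inv_cancel_left₀ h0]
  rw [← ENNReal.ofReal_sum_of_nonneg fun k _ => mul_nonneg (by positivity) (hnn k), h1,
    ENNReal.ofReal_mul (Nat.cast_nonneg N), ENNReal.ofReal_natCast]

/-- A nonnegative fixed point of the Ruelle operator is the density of a harmonic measure. -/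
theorem isHarmonicMeasure_withDensity (N : ℕ) [hN : N.AtLeastTwo] {m₀ : Circ → ℂ}
    (hm : MemLp m₀ ∞ volume) {h : Circ → ℝ} (hint : Integrable h volume)
    (hnn : ∀ᵐ t, 0 ≤ h t) (hR : ruelle N m₀ h =ᵐ[volume] h) :
    IsHarmonicMeasure N (hm.toLp m₀) (volume.withDensity fun t => ENNReal.ofReal (h t)) := by
  have h0 : (0 : ℝ) < N := Nat.cast_pos.2 (by have := hN.prop; omega)
  have hmp := measurePreserving_pow N
  have hofm : AEMeasurable (fun t => ENNReal.ofReal (h t)) volume := hint.aemeasurable.ennreal_ofReal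
  have hm2 : Measurable fun t => ‖hm.toLp m₀ t‖ₑ ^ 2 :=
    (Lp.stronglyMeasurable _).measurable.enorm.pow_const 2
  let F : Circ → ℝ≥0∞ := fun t => ENNReal.ofReal (‖m₀ t‖ ^ 2 * h t)
  have hF : AEMeasurable F volume :=
    ((hm.1.norm.aemeasurable.pow_const 2).mul hint.aemeasurable).ennreal_ofReal
  refine ⟨hmp.measurable, Measure.ext fun E hE => ?_⟩
  have hpre : MeasurableSet ((fun t : Circ => N • t) ⁻¹' E) := hmp.measurable hE
  rw [Measure.map_apply hmp.measurable hE, withDensity_apply _ hpre, withDensity_apply _ hE]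
  let ι : Circ → ℝ≥0∞ := E.indicator 1
  have hι : Measurable ι := measurable_one.indicator hE
  have hlhs : ∫⁻ t in (fun t : Circ => N • t) ⁻¹' E, ‖hm.toLp m₀ t‖ₑ ^ 2
      ∂(volume.withDensity fun t => ENNReal.ofReal (h t)) = ∫⁻ t, ι (N • t) * F t := by
    rw [restrict_withDensity hpre, lintegral_withDensity_eq_lintegral_mul₀ hofm.restrict
      hm2.aemeasurable, ← lintegral_indicator hpre]
    refine lintegral_congr_ae ?_
    filter_upwards [hm.coeFn_toLp, hnn] with t h1 h2
    by_cases ht : N • t ∈ E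
    · have ht' : t ∈ (fun t : Circ => N • t) ⁻¹' E := ht
      rw [Set.indicator_of_mem ht']
      simp only [ι, Set.indicator_of_mem ht, Pi.one_apply, one_mul, F, Pi.mul_apply, h1]
      rw [ENNReal.ofReal_mul (by positivity), ENNReal.ofReal_pow (norm_nonneg _), ofReal_norm,
        mul_comm]
    · have ht' : t ∉ (fun t : Circ => N • t) ⁻¹' E := ht
      rw [Set.indicator_of_notMem ht']
      simp [ι, Set.indicator_of_notMem ht]
  -- z ↦ z^N preserves Haar measure, so the right side can also be written over the covering
  -- variable.
  have hrhs : ∫⁻ t in E, ENNReal.ofReal (h t) = ∫⁻ t, ι (N • t) * ENNReal.ofReal (h (N • t)) := by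
    rw [← lintegral_indicator hE]
    have h1 : AEMeasurable (fun t => ι t * ENNReal.ofReal (h t)) volume := hι.aemeasurable.mul hofm
    have h2 := lintegral_map' (f := fun t => ι t * ENNReal.ofReal (h t)) (μ := volume)
      (g := fun t : Circ => N • t) (by rwa [hmp.map_eq]) hmp.measurable.aemeasurable
    rw [hmp.map_eq] at h2
    rw [← h2]
    refine lintegral_congr fun t => ?_
    by_cases ht : t ∈ E <;> simp [ι, ht]
  rw [hlhs, hrhs]
  -- ι(N • t) is unchanged by translation by k/N. Adding the N translated integrals replaces F by
  -- its sum over a fibre, which R(h) = h evaluates to N h(N • t).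
  have hshift : ∀ k : ℕ, ∫⁻ t, ι (N • t) * F t
      = ∫⁻ t, ι (N • t) * F ((((k : ℝ) / N : ℝ) : Circ) + t) := by
    intro k
    rw [← lintegral_add_left_eq_self _ ((((k : ℝ) / N : ℝ) : Circ))]
    refine lintegral_congr fun t => ?_
    have h1 : N • ((((k : ℝ) / N : ℝ) : Circ) + t) = N • t := by
      rw [nsmul_add, ← AddCircle.coe_nsmul, nsmul_eq_mul, mul_div_cancel₀ _ h0.ne']
      have : ((k : ℝ) : Circ) = 0 :=
        (AddCircle.coe_eq_zero_iff (1 : ℝ)).2 ⟨k, by simp⟩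
      rw [this, zero_add]
    rw [h1]
  have hqmp : ∀ s : Circ, Measure.QuasiMeasurePreserving (fun t : Circ => s + t) volume volume :=
    fun s => (measurePreserving_add_left volume s).quasiMeasurePreserving
  have hsum : (N : ℝ≥0∞) * ∫⁻ t, ι (N • t) * F t
      = N * ∫⁻ t, ι (N • t) * ENNReal.ofReal (h (N • t)) := by
    have h1 : (N : ℝ≥0∞) * ∫⁻ t, ι (N • t) * F t = ∑ k ∈ Finset.range N,
        ∫⁻ t, ι (N • t) * F ((((k : ℝ) / N : ℝ) : Circ) + t) := by
      rw [← Finset.sum_congr rfl fun k _ => hshift k]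
      simp
    have hmeas : ∀ k ∈ Finset.range N,
        AEMeasurable (fun t => ι (N • t) * F ((((k : ℝ) / N : ℝ) : Circ) + t)) volume := fun k _ =>
      (hι.comp hmp.measurable).aemeasurable.mul
        (hF.comp_quasiMeasurePreserving (hqmp (((k : ℝ) / N : ℝ) : Circ)))
    rw [h1, ← lintegral_finsetSum' _ hmeas,
      ← lintegral_const_mul' _ _ (ENNReal.natCast_ne_top N)]
    refine lintegral_congr_ae ?_
    have hall : ∀ᵐ t : Circ, ∀ k : ℕ, 0 ≤ h ((((k : ℝ) / N : ℝ) : Circ) + t) :=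
      ae_all_iff.2 fun k =>
        (hqmp (((k : ℝ) / N : ℝ) : Circ)).ae (p := fun s => 0 ≤ h s) hnn
    filter_upwards [hall, ae_pow N hR] with t h2 h3
    have h4 : ∑ k ∈ Finset.range N, F ((((k : ℝ) / N : ℝ) : Circ) + t)
        = N * ENNReal.ofReal (h (N • t)) := sum_ofReal_eq_of_ruelle N h2 h3
    rw [← Finset.mul_sum, h4, mul_left_comm]
  exact (ENNReal.mul_right_inj (by exact_mod_cast h0.ne') (ENNReal.natCast_ne_top N)).1 hsum

end WaveletRep

/-! ### Existence of the induced representation and splitting off of the wavelet summand -/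

theorem mainTheorem5 (N : ℕ) [N.AtLeastTwo] (m₀ : WaveletRep.Circ → ℂ)
    (hm : WaveletRep.IsWaveletFilter N m₀) (φ : WaveletRep.L2R)
    (hφ : WaveletRep.IsScalingFunction N (hm.memLp.toLp m₀) φ)
    (h : WaveletRep.Circ → ℝ) (hint : Integrable h volume)
    (hR : WaveletRep.ruelle N m₀ h =ᵐ[volume] h)
    (c : ℝ) (hc : 0 < c) (hle : ∀ᵐ t, (WaveletRep.waveletRep N).density φ t ≤ c * h t) :
    (∃ (H : Type) (_ : NormedAddCommGroup H) (_ : InnerProductSpace ℂ H) (_ : CompleteSpace H)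
      (ρ : WaveletRep.NormalRep N H) (Φ : H), ρ.IsInduced (hm.memLp.toLp m₀) h Φ) ∧
    ∀ (H : Type u) [NormedAddCommGroup H] [InnerProductSpace ℂ H] [CompleteSpace H]
      (ρ : WaveletRep.NormalRep N H) (Φ : H), ρ.IsInduced (hm.memLp.toLp m₀) h Φ →
      ∃ (K : Type u) (_ : NormedAddCommGroup K) (_ : InnerProductSpace ℂ K) (_ : CompleteSpace K)
        (σ : WaveletRep.NormalRep N K), ρ.IsDirectSum (WaveletRep.waveletRep N) σ := by
  have hnn : ∀ᵐ t, 0 ≤ h t := by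
    filter_upwards [hle, (WaveletRep.waveletRep N).density_nonneg φ] with t h1 h2
    exact (mul_nonneg_iff_of_pos_left hc).1 (h2.trans h1)
  constructor
  · have : IsFiniteMeasure (volume.withDensity fun t => ENNReal.ofReal (h t)) :=
      isFiniteMeasure_withDensity_ofReal hint.2
    refine (WaveletRep.isHarmonicMeasure_withDensity N hm.memLp hint hnn hR).exists_isInduced
      (withDensity_absolutelyContinuous _ _) h fun f => ?_
    rw [integral_withDensity_eq_integral_toReal_smul₀ hint.aemeasurable.ennreal_ofReal
      (Eventually.of_forall fun _ => ENNReal.ofReal_lt_top)]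
    refine integral_congr_ae ?_
    filter_upwards [hnn] with t ht
    rw [ENNReal.toReal_ofReal ht, Complex.real_smul, mul_comm]
  · intro H _ _ _ ρ Φ hρ
    -- Integrate h_φ ≤ c h against |f|²; the square root of c appears because the norms are squared.
    have hbound : ∀ f : WaveletRep.LInf,
        ‖(WaveletRep.waveletRep N).π f φ‖ ≤ √c * ‖ρ.π f Φ‖ := by
      intro f
      rw [← sq_le_sq₀ (norm_nonneg _) (by positivity), mul_pow, Real.sq_sqrt hc.le,
        ρ.norm_π_sq Φ f hρ.state, WaveletRep.NormalRep.norm_π_sq _ φ f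
          (WaveletRep.NormalRep.inner_π_self _ φ), ← integral_const_mul]
      refine integral_mono_ae
        (WaveletRep.integrable_normSq_mul f (WaveletRep.NormalRep.integrable_density _ φ))
        ((WaveletRep.integrable_normSq_mul f hint).const_mul c) ?_
      filter_upwards [hle] with t ht
      calc ‖f t‖ ^ 2 * (WaveletRep.waveletRep N).density φ t ≤ ‖f t‖ ^ 2 * (c * h t) := by gcongr
        _ = c * (‖f t‖ ^ 2 * h t) := by ring
    obtain ⟨W, hW, hWΦ⟩ := hρ.cyclic.exists_intertwines hρ.scaling hφ.scaling (√c) hbound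
    -- The closure of the range of W is invariant and contains the cyclic vector φ, so W has dense
    -- range and W* has trivial kernel.
    have hinj : Function.Injective (ContinuousLinearMap.adjoint W) := by
      have hcyc := WaveletRep.isCyclicVector_waveletRep hφ.normalized
      have hinv : (WaveletRep.waveletRep N).IsInvariant (LinearMap.range (W : H →ₗ[ℂ] _)) :=
        ⟨by rintro f _ ⟨x, rfl⟩; exact ⟨_, hW.π f x⟩, by rintro _ ⟨x, rfl⟩; exact ⟨_, hW.U x⟩,
          by rintro _ ⟨x, rfl⟩; exact ⟨_, hW.U_symm x⟩⟩
      have htop := hcyc.eq_top hinv.topologicalClosure (Submodule.isClosed_topologicalClosure _)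
        (Submodule.le_topologicalClosure _ ⟨Φ, hWΦ⟩)
      have hbot := (Submodule.topologicalClosure_eq_top_iff).1 htop
      rw [injective_iff_map_eq_zero]
      intro y hy
      rw [← Submodule.mem_bot ℂ, ← hbot, Submodule.mem_orthogonal]
      rintro _ ⟨x, rfl⟩
      change inner ℂ (W x) y = 0
      rw [← ContinuousLinearMap.adjoint_inner_right, hy, inner_zero_right]
    obtain ⟨V, hV⟩ := hW.adjoint.exists_isometry hinj
    obtain ⟨K, hK, σ, hσ⟩ := hV.exists_isDirectSum
    exact ⟨K, inferInstance, inferInstance, hK, σ, hσ⟩
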